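/- Let $E$ be a complex Hilbert space, let $\mathbb{T}$ be the unit circle with normalized Lebesgue measure, and identify the Hardy space $H^2_E(\mathbb{D})$ with the closed subspace of $L^2_E(\mathbb{T})$ of functions whose negative Fourier coefficients vanish. Let $\Phi\in L^\infty_{B(E)}(\mathbb{T})$, that is, $\Phi:\mathbb{T}\to B(E)$ is essentially bounded and $\Phi(\cdot)\eta$ and $\Phi(\cdot)^*\eta$ are strongly measurable for every $\eta\in E$ (for separable $E$ this is just weak measurability of $\Phi$). Let $T_\Phi f=P_{H^2_E(\mathbb{D})}(\Phi f)$ be the Toeplitz operator on $H^2_E(\mathbb{D})$ with symbol $\Phi$, and assume $\|T_\Phi\|\le 1$. Then the following are equivalent: (i) $T_\Phi$ has a unitary part, that is, there is a non-zero closed subspace of $H^2_E(\mathbb{D})$ that reduces $T_\Phi$ and on which $T_\Phi$ is unitary; (ii) there are a non-zero Hilbert space $F$, an inner function $\Theta\in H^\infty_{B(F,E)}(\mathbb{D})$ (a bounded analytic function whose boundary values $\Theta(e^{it}):F\to E$ are isometries for a.e. $t$) and a unitary $U:F\to F$ such that $$\Phi(e^{it})\Theta(e^{it})=\Theta(e^{it})U\quad\text{and}\quad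 \Phi(e^{it})^*\Theta(e^{it})=\Theta(e^{it})U^*\qquad\text{a.e. on }\mathbb{T}.$$ In this case, there is a largest closed subspace $\mathcal{M}_{T_\Phi}$ of $H^2_E(\mathbb{D})$ that reduces $T_\Phi$ and on which $T_\Phi$ is unitary, and $T_\Phi|_{\mathcal{M}_{T_\Phi}}$ is unitarily equivalent to a constant unitary: there are a Hilbert space $F$, a unitary $U$ on $F$, and a unitary $V:H^2_F(\mathbb{D})\to\mathcal{M}_{T_\Phi}$ with $T_\Phi V=V\,T_U$, where $T_U$ is the Toeplitz operator on $H^2_F(\mathbb{D})$ with constant symbol $U$. -/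

import Mathlib

open MeasureTheory AddCircle
open scoped ENNReal

universe u v

namespace ToeplitzUnitaryPart

/-! ### Function spaces on the circle

The circle `𝕋` is `UnitAddCircle = ℝ / ℤ`, where `x` stands for the point `e^{2πix}`; its measure
is the normalized Lebesgue measure `haarAddCircle`, and `fourierCoeff f n` is
`∫ e^{-2πinx} f(x) dx`. -/

/-- The space `L²_E(𝕋)` of square integrable `E`-valued functions. -/
abbrev L2 (E : Type u) [NormedAddCommGroup E] : Type u :=
  Lp E 2 (haarAddCircle : Measure UnitAddCircle)

section Hardy

variable (E : Type u) [NormedAddCommGroup E] [InnerProductSpace ℂ E]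

theorem L2.integrable {E : Type u} [NormedAddCommGroup E] (f : L2 E) :
    Integrable (f : UnitAddCircle → E) haarAddCircle :=
  (Lp.memLp f).integrable one_le_two

/-- The `n`-th Fourier coefficient as a linear map on `L²_E(𝕋)`. -/
noncomputable def coeffLM (n : ℤ) : L2 E →ₗ[ℂ] E where
  toFun f := fourierCoeff (f : UnitAddCircle → E) n
  map_add' f g := by
    rw [fourierCoeff_congr_ae (Lp.coeFn_add f g), fourierCoeff.add f.integrable g.integrable]
    rfl
  map_smul' c f := by
    rw [fourierCoeff_congr_ae (Lp.coeFn_smul c f), fourierCoeff.const_smul]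
    rfl

theorem norm_coeffLM_le (n : ℤ) (f : L2 E) : ‖coeffLM E n f‖ ≤ 1 * ‖f‖ := by
  have h1 : ‖coeffLM E n f‖ ≤ ∫ t, ‖f t‖ ∂(haarAddCircle : Measure UnitAddCircle) := by
    refine (norm_integral_le_integral_norm _).trans (le_of_eq ?_)
    refine integral_congr_ae (Filter.Eventually.of_forall fun t => ?_)
    simp [norm_smul, Circle.norm_coe]
  have h2 : ∫ t, ‖f t‖ ∂(haarAddCircle : Measure UnitAddCircle)
      = (eLpNorm f 1 (haarAddCircle : Measure UnitAddCircle)).toReal := by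
    rw [eLpNorm_one_eq_lintegral_enorm, integral_norm_eq_lintegral_enorm f.integrable.1]
  rw [one_mul, Lp.norm_def]
  refine h1.trans (h2.le.trans ?_)
  exact ENNReal.toReal_mono (Lp.eLpNorm_ne_top f)
    (eLpNorm_le_eLpNorm_of_exponent_le one_le_two (Lp.aestronglyMeasurable f))

/-- The Hardy space `H²_E(𝔻)`, identified in the usual way with a subspace of `L²_E(𝕋)`: the
power series `∑ aₙ zⁿ` with `∑ ‖aₙ‖² < ∞` corresponds to the function in `L²_E(𝕋)` with `n`-th
Fourier coefficient `aₙ` for `n ≥ 0` and `0` for `n < 0`. -/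
noncomputable def Hardy : Submodule ℂ (L2 E) where
  carrier := {f | ∀ n : ℤ, n < 0 → fourierCoeff (f : UnitAddCircle → E) n = 0}
  add_mem' {f g} hf hg n hn := by
    have := (coeffLM E n).map_add f g
    simp only [coeffLM, LinearMap.coe_mk, AddHom.coe_mk] at this
    rw [this, hf n hn, hg n hn, add_zero]
  zero_mem' n _ := (coeffLM E n).map_zero
  smul_mem' c f hf n hn := by
    have := (coeffLM E n).map_smul c f
    simp only [coeffLM, LinearMap.coe_mk, AddHom.coe_mk] at this
    rw [this, hf n hn, smul_zero]

theorem isClosed_hardy : IsClosed (Hardy E : Set (L2 E)) := by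
  have : (Hardy E : Set (L2 E)) = ⋂ (n : ℤ) (_ : n < 0),
      ((coeffLM E n).mkContinuous 1 (norm_coeffLM_le E n)) ⁻¹' {0} := by
    ext f
    simp only [Set.mem_iInter, Set.mem_preimage, Set.mem_singleton_iff]
    rfl
  rw [this]
  exact isClosed_iInter fun n => isClosed_iInter fun _ =>
    isClosed_singleton.preimage (ContinuousLinearMap.continuous _)

instance [CompleteSpace E] : CompleteSpace (Hardy E) :=
  (isClosed_hardy E).completeSpace_coe

end Hardy

/-! ### Symbols, Laurent operators and Toeplitz operators -/

section Toeplitz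

variable {E : Type u} [NormedAddCommGroup E] [InnerProductSpace ℂ E] [CompleteSpace E]

/-- `Φ ∈ L^∞_{B(E)}(𝕋)`: an essentially bounded operator-valued function, measurable in the strong
operator topology together with its pointwise adjoint. For separable `E` this is the same as weak
measurability of `Φ` (Pettis), and the clause on adjoints is automatic; it matters only for
nonseparable `E`, where it ensures that `Φ` and `Φ*` both act on `E`-valued functions. -/
structure MemLInfty (Φ : UnitAddCircle → E →L[ℂ] E) : Prop where
  aesm : ∀ η : E, AEStronglyMeasurable (fun t => Φ t η) haarAddCircle
  aesm_adjoint : ∀ η : E,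
    AEStronglyMeasurable (fun t => ContinuousLinearMap.adjoint (Φ t) η) haarAddCircle
  bdd : ∃ C : ℝ, ∀ᵐ t ∂haarAddCircle, ‖Φ t‖ ≤ C

theorem MemLInfty.const (A : E →L[ℂ] E) : MemLInfty (fun _ : UnitAddCircle => A) where
  aesm _ := aestronglyMeasurable_const
  aesm_adjoint _ := aestronglyMeasurable_const
  bdd := ⟨‖A‖, Filter.Eventually.of_forall fun _ => le_rfl⟩

variable {Φ : UnitAddCircle → E →L[ℂ] E}

theorem MemLInfty.aesm_apply (hΦ : MemLInfty Φ) (f : L2 E) :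
    AEStronglyMeasurable (fun t => Φ t (f t)) haarAddCircle := by
  have hf := Lp.stronglyMeasurable f
  refine aestronglyMeasurable_of_tendsto_ae Filter.atTop (f := fun n t => Φ t (hf.approx n t))
    (fun n => ?_) (Filter.Eventually.of_forall fun t =>
      ((Φ t).continuous.tendsto _).comp (hf.tendsto_approx t))
  have : (fun t => Φ t (hf.approx n t)) = fun t => ∑ y ∈ (hf.approx n).range,
      ((hf.approx n) ⁻¹' {y}).indicator (fun t => Φ t y) t := by
    funext t
    rw [Finset.sum_eq_single (hf.approx n t)]
    · simp
    · intro y _ hy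
      exact Set.indicator_of_notMem (fun h => hy h.symm) _
    · intro h
      exact absurd (SimpleFunc.mem_range_self _ t) h
  rw [this]
  exact Finset.aestronglyMeasurable_fun_sum _ fun y _ =>
    (hΦ.aesm y).indicator ((hf.approx n).measurableSet_preimage _)

theorem MemLInfty.memLp_apply (hΦ : MemLInfty Φ) (f : L2 E) :
    MemLp (fun t => Φ t (f t)) 2 (haarAddCircle : Measure UnitAddCircle) := by
  obtain ⟨C, hC⟩ := hΦ.bdd
  refine (Lp.memLp f).of_le_mul (c := C) (hΦ.aesm_apply f) ?_
  filter_upwards [hC] with t ht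
  exact (Φ t).le_of_opNorm_le ht _

/-- The Laurent operator `L_Φ` on `L²_E(𝕋)`, `(L_Φ f)(z) = Φ(z) f(z)`. -/
noncomputable def laurent (Φ : UnitAddCircle → E →L[ℂ] E) (hΦ : MemLInfty Φ) : L2 E →L[ℂ] L2 E :=
  LinearMap.mkContinuousOfExistsBound
    { toFun := fun f => (hΦ.memLp_apply f).toLp
      map_add' := fun f g => by
        rw [← MemLp.toLp_add]
        refine MemLp.toLp_congr _ _ ?_
        filter_upwards [Lp.coeFn_add f g] with t ht
        rw [ht]
        simp
      map_smul' := fun c f => by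
        rw [RingHom.id_apply, ← MemLp.toLp_const_smul]
        refine MemLp.toLp_congr _ _ ?_
        filter_upwards [Lp.coeFn_smul c f] with t ht
        rw [ht]
        simp }
    (by
      obtain ⟨C, hC⟩ := hΦ.bdd
      refine ⟨C, fun f => Lp.norm_le_mul_norm_of_ae_le_mul ?_⟩
      filter_upwards [hC, (hΦ.memLp_apply f).coeFn_toLp] with t ht h
      simp only [LinearMap.coe_mk, AddHom.coe_mk, h]
      exact (Φ t).le_of_opNorm_le ht _)

/-- The defining property of the Laurent operator. -/
theorem laurent_apply_ae (hΦ : MemLInfty Φ) (f : L2 E) :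
    laurent Φ hΦ f =ᵐ[haarAddCircle] fun t => Φ t (f t) :=
  (hΦ.memLp_apply f).coeFn_toLp

/-- The Toeplitz operator `T_Φ = P_{H²} L_Φ|_{H²}` with symbol `Φ`. -/
noncomputable def toeplitz (Φ : UnitAddCircle → E →L[ℂ] E) (hΦ : MemLInfty Φ) : Hardy E →L[ℂ] Hardy E :=
  (Hardy E).orthogonalProjectionOnto ∘L laurent Φ hΦ ∘L (Hardy E).subtypeL

end Toeplitz

/-! ### Unitary parts of operators -/

section UnitaryPart

variable {H : Type u} [NormedAddCommGroup H] [InnerProductSpace ℂ H] [CompleteSpace H]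

/-- `M` is a (closed) reducing subspace for `T`. -/
structure IsReducing (T : H →L[ℂ] H) (M : Submodule ℂ H) : Prop where
  isClosed : IsClosed (M : Set H)
  map_mem : ∀ x ∈ M, T x ∈ M
  adjoint_mem : ∀ x ∈ M, ContinuousLinearMap.adjoint T x ∈ M

/-- `T` maps `M` isometrically onto `M`, that is, `T|_M` is a unitary operator on `M`. -/
structure IsUnitaryOn (T : H →L[ℂ] H) (M : Submodule ℂ H) : Prop where
  map_mem : ∀ x ∈ M, T x ∈ M
  norm_map : ∀ x ∈ M, ‖T x‖ = ‖x‖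
  surj : ∀ y ∈ M, ∃ x ∈ M, T x = y

/-- `T` has a unitary part: there is a non-zero reducing subspace on which `T` is unitary. -/
def HasUnitaryPart (T : H →L[ℂ] H) : Prop :=
  ∃ M : Submodule ℂ H, M ≠ ⊥ ∧ IsReducing T M ∧ IsUnitaryOn T M

/-- `M` is the space of the unitary part of `T`, that is, the largest reducing subspace on which
`T` is unitary (the unitary space in the canonical decomposition of a contraction). -/
def IsUnitarySpace (T : H →L[ℂ] H) (M : Submodule ℂ H) : Prop :=
  IsGreatest {N : Submodule ℂ H | IsReducing T N ∧ IsUnitaryOn T N} M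

end UnitaryPart

/-! ### Bounded analytic functions and inner functions -/

section Inner

variable {F : Type v} {E : Type u} [NormedAddCommGroup F] [InnerProductSpace ℂ F]
  [NormedAddCommGroup E] [InnerProductSpace ℂ E]

/-- `Θ ∈ H^∞_{B(F,E)}(𝔻)`: a bounded analytic function on the open unit disc. -/
structure MemHInfty (Θ : ℂ → F →L[ℂ] E) : Prop where
  analytic : DifferentiableOn ℂ Θ (Metric.ball 0 1)
  bdd : ∃ C : ℝ, ∀ z ∈ Metric.ball (0 : ℂ) 1, ‖Θ z‖ ≤ C

/-- `B` is the boundary function `e^{it} ↦ Θ(e^{it})` on `𝕋` of the function `Θ` on the disc: `B`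
is strongly measurable and essentially bounded, and for each `η` the function `B(·)η` has Fourier
series `∑_{n ≥ 0} aₙ e^{int}`, where `Θ(z)η = ∑_{n ≥ 0} aₙ zⁿ` in the disc. This is the same
identification of functions on the disc with functions on the circle as in `Hardy`. -/
structure IsBoundaryFunction (Θ : ℂ → F →L[ℂ] E) (B : UnitAddCircle → F →L[ℂ] E) : Prop where
  aesm : ∀ η : F, AEStronglyMeasurable (fun t => B t η) haarAddCircle
  bdd : ∃ C : ℝ, ∀ᵐ t ∂haarAddCircle, ‖B t‖ ≤ C
  coeff_neg : ∀ (η : F) (n : ℤ), n < 0 → fourierCoeff (fun t => B t η) n = 0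
  hasSum : ∀ (η : F), ∀ z ∈ Metric.ball (0 : ℂ) 1,
    HasSum (fun n : ℕ => z ^ n • fourierCoeff (fun t => B t η) (n : ℤ)) (Θ z η)

/-- `Θ ∈ H^∞_{B(F,E)}(𝔻)`, with boundary function `B`, is inner: `Θ(e^{it})` is an isometry for
almost every `t`. -/
structure IsInner (Θ : ℂ → F →L[ℂ] E) (B : UnitAddCircle → F →L[ℂ] E) : Prop where
  memHInfty : MemHInfty Θ
  isBoundary : IsBoundaryFunction Θ B
  isometry : ∀ᵐ t ∂haarAddCircle, Isometry (B t)

end Inner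

end ToeplitzUnitaryPart

namespace ToeplitzUnitaryPart

/-! ### Uniqueness of Fourier coefficients -/

section Fourier

variable {E : Type*} [NormedAddCommGroup E] [NormedSpace ℂ E]

/-! The key is the rigidity of norm preservation. Let `S` be the shift, `T = T_Φ` a contraction and
`‖T f‖ = ‖f‖`. Put `p = T f` and `r = Φ f - p`, so `r ⊥ H²`. Then `T (S^k f) = S^k p + P (e_k r)` is
an orthogonal sum of norm at most `‖f‖ = ‖S^k p‖`. Hence `P (e_k r) = 0` for every `k ≥ 0`, which
leaves `r` no Fourier coefficient. So `T f = Φ f`, and `T` commutes with all `S^k` at `f`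
(`laurent_mem_hardy_of_norm_eq`). The same holds for `T*`, the Toeplitz operator of `Φ*`.

The unitary space `M` consists of the vectors whose norm is preserved by all powers of `T` and `T*`
(`exists_isUnitarySpace`). By rigidity `M` is `S`-invariant and `T`, `T*` commute with `S` on it, so
`W = M ⊖ S M` reduces `T` to a unitary `U`. Since `S` is pure, the Wold decomposition gives `M = ⨁
S^k W`, and `e_k w ↦ S^k w` carries `T_U` to `T` on `M`.

For `f`, `g` in `W` the function `⟨f(t), g(t)⟩` has `n`-th Fourier coefficient `⟨e_n f, g⟩`, zero
for `n ≠ 0`, so it is a.e. constant (`inner_apply_ae_of_mem_wandering`). Up to null sets, evaluation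
at `t` is therefore an isometry into `E`; a separable reducing subspace of `W` makes one null set
suffice (`exists_isometry_field`). These isometries are the boundary values of `Θ`, and `Φ f = T f`
gives the intertwining relations. Conversely, the functions `Θ η` alone form a reducing subspace on
which `T` acts as `U`. -/

theorem norm_fourier_apply (n : ℤ) (t : UnitAddCircle) : ‖fourier n t‖ = 1 := Circle.norm_coe _

/-- Integration against `f` is bounded for the sup norm and kills every character, and characters
span a dense subspace of the continuous functions. -/
theorem integral_continuousMap_smul_eq_zero {f : UnitAddCircle → E}
    (hf : Integrable f haarAddCircle) (h : ∀ n, fourierCoeff f n = 0) (g : C(UnitAddCircle, ℂ)) :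
    ∫ t, g t • f t ∂haarAddCircle = 0 := by
  have hint : ∀ g : C(UnitAddCircle, ℂ), Integrable (fun t => g t • f t) haarAddCircle := fun g =>
    hf.bdd_smul ‖g‖ g.continuous.aestronglyMeasurable
      (Filter.Eventually.of_forall fun t => g.norm_coe_le_norm t)
  let L : C(UnitAddCircle, ℂ) →ₗ[ℂ] E :=
    { toFun := fun g => ∫ t, g t • f t ∂haarAddCircle
      map_add' := fun g₁ g₂ => by
        rw [← integral_add (hint g₁) (hint g₂)]
        simp [add_smul]
      map_smul' := fun c g => by
        rw [RingHom.id_apply, ← integral_smul]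
        simp [mul_smul] }
  have hL : ∀ g, ‖L g‖ ≤ (∫ t, ‖f t‖ ∂haarAddCircle) * ‖g‖ := fun g => by
    refine (norm_integral_le_integral_norm _).trans ?_
    rw [← integral_mul_const]
    refine integral_mono (hint g).norm (hf.norm.mul_const _) fun t => ?_
    simp only [norm_smul]
    rw [mul_comm]
    exact mul_le_mul_of_nonneg_left (g.norm_coe_le_norm t) (norm_nonneg _)
  let L' := L.mkContinuous _ hL
  have hker : IsClosed (L'.ker : Set C(UnitAddCircle, ℂ)) := L'.isClosed_ker
  have hle : (⊤ : Submodule ℂ C(UnitAddCircle, ℂ)) ≤ L'.ker := by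
    rw [← span_fourier_closure_eq_top]
    refine Submodule.topologicalClosure_minimal _ (Submodule.span_le.2 ?_) hker
    rintro _ ⟨n, rfl⟩
    have := h (-n)
    rw [fourierCoeff, neg_neg] at this
    exact this
  exact hle (Submodule.mem_top (x := g))

/-- Indicators of closed sets are bounded pointwise limits of continuous functions, so dominated
convergence makes every integral of `f` over a closed set vanish. -/
theorem ae_eq_zero_of_fourierCoeff_eq_zero [CompleteSpace E] {f : UnitAddCircle → E}
    (hf : Integrable f haarAddCircle) (h : ∀ n, fourierCoeff f n = 0) :
    f =ᵐ[haarAddCircle] 0 := by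
  refine ae_eq_zero_of_forall_setIntegral_isClosed_eq_zero hf fun s hs => ?_
  have hlim : Filter.Tendsto (fun n => ∫ t, ((hs.apprSeq n t : ℝ) : ℂ) • f t ∂haarAddCircle)
      Filter.atTop (nhds (∫ t, s.indicator f t ∂haarAddCircle)) := by
    refine tendsto_integral_of_dominated_convergence (fun t => ‖f t‖) (fun n => ?_) hf.norm
      (fun n => Filter.Eventually.of_forall fun t => ?_)
      (Filter.Eventually.of_forall fun t => ?_)
    · refine AEStronglyMeasurable.smul (Continuous.aestronglyMeasurable ?_) hf.1
      exact Complex.continuous_ofReal.comp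
        (NNReal.continuous_coe.comp (hs.apprSeq n).continuous)
    · rw [norm_smul, Complex.norm_real]
      refine mul_le_of_le_one_left (norm_nonneg _) ?_
      rw [Real.norm_of_nonneg NNReal.zero_le_coe]
      exact_mod_cast HasOuterApproxClosed.apprSeq_apply_le_one hs n t
    · have h1 : Filter.Tendsto (fun n => hs.apprSeq n t) Filter.atTop
          (nhds (s.indicator (fun _ => (1 : NNReal)) t)) :=
        (tendsto_pi_nhds.1 (HasOuterApproxClosed.tendsto_apprSeq hs)) t
      have h2 := (((Complex.continuous_ofReal.comp NNReal.continuous_coe).tendsto _).comp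
        h1).smul_const (f t)
      convert! h2 using 2
      by_cases ht : t ∈ s <;> simp [ht]
  have hz : ∀ n, ∫ t, ((hs.apprSeq n t : ℝ) : ℂ) • f t ∂haarAddCircle = 0 := fun n =>
    integral_continuousMap_smul_eq_zero hf h
      ⟨fun t => ((hs.apprSeq n t : ℝ) : ℂ), Complex.continuous_ofReal.comp
        (NNReal.continuous_coe.comp (hs.apprSeq n).continuous)⟩
  simp_rw [hz] at hlim
  rw [← integral_indicator hs.measurableSet]
  exact (tendsto_nhds_unique hlim tendsto_const_nhds)

theorem fourierCoeff_const [CompleteSpace E] (η : E) (n : ℤ) :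
    fourierCoeff (fun _ : UnitAddCircle => η) n = if n = 0 then η else 0 := by
  rw [fourierCoeff, integral_smul_const]
  have h := (orthonormal_iff_ite.1 (orthonormal_fourier (T := 1))) n 0
  rw [fourierLp, fourierLp, ContinuousMap.inner_toLp] at h
  simp_rw [← fourier_neg, fourier_zero, one_mul] at h
  rw [h]
  simp

end Fourier

/-! ### Multiplication by characters on `L²` -/

section Mul

variable {E : Type u} [NormedAddCommGroup E] [InnerProductSpace ℂ E]

theorem L2.eq_zero_of_fourierCoeff [CompleteSpace E] {f : L2 E}
    (h : ∀ n, fourierCoeff (f : UnitAddCircle → E) n = 0) : f = 0 :=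
  (Lp.eq_zero_iff_ae_eq_zero).2 (ae_eq_zero_of_fourierCoeff_eq_zero f.integrable h)

theorem memLp_fourier_smul (k : ℤ) (f : L2 E) :
    MemLp (fun t => fourier k t • f t) 2 (haarAddCircle : Measure UnitAddCircle) := by
  refine (Lp.memLp f).of_le_mul (c := 1) ?_ (Filter.Eventually.of_forall fun t => ?_)
  · exact (fourier k).continuous.aestronglyMeasurable.smul (Lp.aestronglyMeasurable f)
  · rw [norm_smul, norm_fourier_apply]

/-- Multiplication by the character `e_k` as a linear isometry of `L²_E(𝕋)`. -/
noncomputable def charMul (k : ℤ) : L2 E →ₗᵢ[ℂ] L2 E where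
  toFun f := (memLp_fourier_smul k f).toLp
  map_add' f g := by
    rw [← MemLp.toLp_add]
    refine MemLp.toLp_congr _ _ ?_
    filter_upwards [Lp.coeFn_add f g] with t ht
    rw [ht]
    simp
  map_smul' c f := by
    rw [RingHom.id_apply, ← MemLp.toLp_const_smul]
    refine MemLp.toLp_congr _ _ ?_
    filter_upwards [Lp.coeFn_smul c f] with t ht
    rw [ht]
    exact smul_comm _ _ _
  norm_map' f := by
    simp only [LinearMap.coe_mk, AddHom.coe_mk]
    rw [Lp.norm_toLp, Lp.norm_def]
    congr 1
    refine eLpNorm_congr_norm_ae (Filter.Eventually.of_forall fun t => ?_)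
    rw [norm_smul, norm_fourier_apply, one_mul]

theorem charMul_ae (k : ℤ) (f : L2 E) :
    charMul k f =ᵐ[haarAddCircle] fun t => fourier k t • f t :=
  (memLp_fourier_smul k f).coeFn_toLp

theorem charMul_charMul (j k : ℤ) (f : L2 E) : charMul j (charMul k f) = charMul (j + k) f := by
  refine Lp.ext ?_
  filter_upwards [charMul_ae j (charMul k f), charMul_ae k f, charMul_ae (j + k) f] with t h1 h2 h3
  rw [h1, h2, h3, smul_smul, fourier_add]

theorem charMul_zero (f : L2 E) : charMul 0 f = f := by
  refine Lp.ext ?_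
  filter_upwards [charMul_ae 0 f] with t h1
  simp [h1]

theorem inner_charMul_left (k : ℤ) (f g : L2 E) :
    inner ℂ (charMul k f) g = inner ℂ f (charMul (-k) g) := by
  rw [← (charMul k).inner_map_map f, charMul_charMul, add_neg_cancel, charMul_zero]

theorem fourierCoeff_charMul (k n : ℤ) (f : L2 E) :
    fourierCoeff (charMul k f : UnitAddCircle → E) n =
      fourierCoeff (f : UnitAddCircle → E) (n - k) := by
  rw [fourierCoeff_congr_ae (charMul_ae k f)]
  simp only [fourierCoeff, smul_smul, ← fourier_add]
  congr! 4
  ring_nf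

theorem charMul_mem_hardy {k : ℤ} (hk : 0 ≤ k) {f : L2 E} (hf : f ∈ Hardy E) :
    charMul k f ∈ Hardy E := fun n hn => by
  rw [fourierCoeff_charMul]
  exact hf _ (by lia)

theorem laurent_charMul [CompleteSpace E] {Φ : UnitAddCircle → E →L[ℂ] E} (hΦ : MemLInfty Φ)
    (k : ℤ) (f : L2 E) : laurent Φ hΦ (charMul k f) = charMul k (laurent Φ hΦ f) := by
  refine Lp.ext ?_
  filter_upwards [laurent_apply_ae hΦ (charMul k f), laurent_apply_ae hΦ f, charMul_ae k f,
    charMul_ae k (laurent Φ hΦ f)] with t h1 h2 h3 h4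
  rw [h1, h3, h4, h2, map_smul]

/-- The constant function with value `η`. -/
noncomputable def constL2 : E →ₗᵢ[ℂ] L2 E where
  toLinearMap := (Lp.constₗ 2 haarAddCircle ℂ : E →ₗ[ℂ] L2 E)
  norm_map' η := by
    change ‖Lp.const 2 haarAddCircle η‖ = ‖η‖
    rw [Lp.norm_const'] <;> simp

theorem constL2_ae (η : E) : constL2 η =ᵐ[haarAddCircle] fun _ => η :=
  Lp.coeFn_const ..

/-- Turns orthogonality to monomials into vanishing of Fourier coefficients. -/
theorem inner_charMul_constL2 [CompleteSpace E] (n : ℤ) (η : E) (f : L2 E) :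
    inner ℂ (charMul n (constL2 η)) f = inner ℂ η (fourierCoeff (f : UnitAddCircle → E) n) := by
  rw [L2.inner_def, fourierCoeff, ← integral_inner (by exact f.integrable.fourier_smul (-n))]
  refine integral_congr_ae ?_
  filter_upwards [charMul_ae n (constL2 η), constL2_ae η] with t h1 h2
  rw [h1, h2, inner_smul_left, inner_smul_right, fourier_neg]

theorem fourierCoeff_charMul_constL2 [CompleteSpace E] (m n : ℤ) (η : E) :
    fourierCoeff (charMul m (constL2 η) : UnitAddCircle → E) n = if n = m then η else 0 := by
  rw [fourierCoeff_charMul]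
  rw [fourierCoeff_congr_ae (constL2_ae η), fourierCoeff_const]
  simp [sub_eq_zero]

end Mul

/-! ### The shift on the Hardy space and Toeplitz operators -/

section Shift

variable {E : Type u} [NormedAddCommGroup E] [InnerProductSpace ℂ E]

/-- Multiplication by the character `e_k`, `k ≥ 0`, as a linear isometry of `H²_E(𝔻)`. -/
noncomputable def hardyMul (k : ℕ) : Hardy E →ₗᵢ[ℂ] Hardy E where
  toFun f := ⟨charMul (k : ℤ) (f : L2 E), charMul_mem_hardy (Int.natCast_nonneg k) f.2⟩
  map_add' f g := Subtype.ext ((charMul (k : ℤ)).map_add (f : L2 E) g)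
  map_smul' c f := Subtype.ext ((charMul (k : ℤ)).map_smul c (f : L2 E))
  norm_map' f := (charMul (k : ℤ)).norm_map (f : L2 E)

@[simp]
theorem coe_hardyMul (k : ℕ) (f : Hardy E) : (hardyMul k f : L2 E) = charMul (k : ℤ) f := rfl

theorem hardyMul_hardyMul (j k : ℕ) (f : Hardy E) :
    hardyMul j (hardyMul k f) = hardyMul (j + k) f :=
  Subtype.ext <| by simp [charMul_charMul]

theorem hardyMul_zero (f : Hardy E) : hardyMul 0 f = f :=
  Subtype.ext <| by simp [charMul_zero]

/-- Purity of the shift, which excludes a unitary summand in the Wold decomposition. -/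
theorem eq_zero_of_forall_mem_range_hardyMul [CompleteSpace E] {f : Hardy E}
    (h : ∀ k : ℕ, ∃ g, hardyMul k g = f) : f = 0 := by
  refine Subtype.ext (L2.eq_zero_of_fourierCoeff fun n => ?_)
  -- One step more than `n`, so that the `n`-th coefficient of `f` is a negative one of `g`.
  obtain ⟨g, rfl⟩ := h (n.toNat + 1)
  rw [coe_hardyMul, fourierCoeff_charMul]
  exact g.2 _ (by lia)

end Shift

section Toeplitz

variable {E : Type u} [NormedAddCommGroup E] [InnerProductSpace ℂ E] [CompleteSpace E]
  {Φ : UnitAddCircle → E →L[ℂ] E}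

theorem MemLInfty.adjoint (hΦ : MemLInfty Φ) :
    MemLInfty (fun t => ContinuousLinearMap.adjoint (Φ t)) where
  aesm := hΦ.aesm_adjoint
  aesm_adjoint := by simpa using hΦ.aesm
  bdd := by simpa using hΦ.bdd

theorem inner_toeplitz_right (hΦ : MemLInfty Φ) (f g : Hardy E) :
    inner ℂ f (toeplitz Φ hΦ g) = inner ℂ (f : L2 E) (laurent Φ hΦ g) := by
  simp only [toeplitz, ContinuousLinearMap.comp_apply, Submodule.subtypeL_apply]
  exact Submodule.inner_orthogonalProjectionOnto_eq_of_mem_left _ _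

theorem adjoint_laurent (hΦ : MemLInfty Φ) :
    ContinuousLinearMap.adjoint (laurent Φ hΦ) = laurent _ hΦ.adjoint := by
  symm
  rw [ContinuousLinearMap.eq_adjoint_iff]
  intro f g
  rw [L2.inner_def, L2.inner_def]
  refine integral_congr_ae ?_
  filter_upwards [laurent_apply_ae hΦ g, laurent_apply_ae hΦ.adjoint f] with t h1 h2
  rw [h1, h2, ContinuousLinearMap.adjoint_inner_left]

theorem adjoint_toeplitz (hΦ : MemLInfty Φ) :
    ContinuousLinearMap.adjoint (toeplitz Φ hΦ) = toeplitz _ hΦ.adjoint := by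
  symm
  rw [ContinuousLinearMap.eq_adjoint_iff]
  intro f g
  rw [inner_toeplitz_right, ← inner_conj_symm, inner_toeplitz_right, inner_conj_symm,
    ← adjoint_laurent, ContinuousLinearMap.adjoint_inner_left]

theorem coe_toeplitz_of_mem (hΦ : MemLInfty Φ) {f : Hardy E} (h : laurent Φ hΦ f ∈ Hardy E) :
    (toeplitz Φ hΦ f : L2 E) = laurent Φ hΦ f :=
  (Hardy E).starProjection_eq_self_iff.2 h

theorem toeplitz_hardyMul_of_mem (hΦ : MemLInfty Φ) {f : Hardy E}
    (h : laurent Φ hΦ f ∈ Hardy E) (k : ℕ) :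
    toeplitz Φ hΦ (hardyMul k f) = hardyMul k (toeplitz Φ hΦ f) := by
  have h1 : laurent Φ hΦ (hardyMul k f) = charMul (k : ℤ) (laurent Φ hΦ f) :=
    laurent_charMul hΦ k f
  refine Subtype.ext ?_
  rw [coe_toeplitz_of_mem hΦ (h1 ▸ charMul_mem_hardy (Int.natCast_nonneg k) h), h1,
    coe_hardyMul, coe_toeplitz_of_mem hΦ h]

theorem eq_zero_of_charMul_mem_hardy_orthogonal {g : L2 E}
    (h : ∀ k : ℕ, charMul (k : ℤ) g ∈ (Hardy E)ᗮ) : g = 0 := by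
  refine L2.eq_zero_of_fourierCoeff fun n => ?_
  -- Shifting by `|n|` moves the `n`-th coefficient of `g` to the index `n + |n| ≥ 0`, where `H²`
  -- contains a monomial to test it against.
  have hmem : charMul (n + n.natAbs) (constL2 (fourierCoeff (g : UnitAddCircle → E) n)) ∈
      Hardy E := fun m hm => by
    rw [fourierCoeff_charMul_constL2, if_neg (by lia)]
  have h1 := (Submodule.mem_orthogonal _ _).1 (h n.natAbs) _ hmem
  rw [inner_charMul_constL2, fourierCoeff_charMul] at h1
  simpa using h1

/-- If a contractive Toeplitz operator preserves the norm of `f`, then it acts on `f` as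
multiplication by its symbol. -/
theorem laurent_mem_hardy_of_norm_eq (hΦ : MemLInfty Φ) (hT : ‖toeplitz Φ hΦ‖ ≤ 1) {f : Hardy E}
    (hf : ‖toeplitz Φ hΦ f‖ = ‖f‖) : laurent Φ hΦ f ∈ Hardy E := by
  set p : Hardy E := toeplitz Φ hΦ f with hp
  set r : L2 E := laurent Φ hΦ f - p with hr
  have hr_orth : r ∈ (Hardy E)ᗮ := (Hardy E).sub_starProjection_mem_orthogonal _
  suffices r = 0 by
    rw [sub_eq_zero] at this
    rw [this]
    exact p.2
  refine eq_zero_of_charMul_mem_hardy_orthogonal fun k => ?_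
  set q : Hardy E := (Hardy E).orthogonalProjectionOnto (charMul (k : ℤ) r) with hq
  have h1 : toeplitz Φ hΦ (hardyMul k f) = hardyMul k p + q := by
    have : laurent Φ hΦ (hardyMul k f) = (hardyMul k p : L2 E) + charMul (k : ℤ) r := by
      rw [coe_hardyMul, laurent_charMul, coe_hardyMul, ← map_add, hr, add_sub_cancel]
    simp only [toeplitz, ContinuousLinearMap.comp_apply, Submodule.subtypeL_apply]
    rw [this, map_add, Submodule.orthogonalProjectionOnto_mem_subspace_eq_self]
  have h2 : inner ℂ (hardyMul k p) q = 0 := by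
    rw [hq, Submodule.inner_orthogonalProjectionOnto_eq_of_mem_left, coe_hardyMul,
      LinearIsometry.inner_map_map]
    exact (Submodule.mem_orthogonal _ _).1 hr_orth _ p.2
  -- Contractivity at `S^k f`, whose norm is `‖f‖ = ‖p‖`; by Pythagoras this leaves no room for `q`.
  have h3 : ‖hardyMul k p + q‖ ≤ ‖hardyMul k p‖ := by
    rw [← h1, LinearIsometry.norm_map, hf]
    refine ((toeplitz Φ hΦ).le_of_opNorm_le hT _).trans ?_
    rw [one_mul, LinearIsometry.norm_map]
  have h4 := norm_add_sq_eq_norm_sq_add_norm_sq_of_inner_eq_zero (𝕜 := ℂ) (hardyMul k p) q h2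
  have h5 : ‖q‖ = 0 := by nlinarith [norm_nonneg q, norm_nonneg (hardyMul k p + q)]
  exact Submodule.orthogonalProjectionOnto_eq_zero_iff.1 (norm_eq_zero.1 h5)

end Toeplitz

/-! ### The unitary space of a contraction -/

section UnitarySpace

variable {H : Type u} [NormedAddCommGroup H] [InnerProductSpace ℂ H] [CompleteSpace H]
  {T : H →L[ℂ] H}

/-- Expand `‖T* T x - x‖²`: the cross term is `-2 ‖T x‖² = -2 ‖x‖²`, and `‖T* T x‖ ≤ ‖x‖`. -/
theorem adjoint_apply_self_of_norm_eq (hT : ‖T‖ ≤ 1) {x : H} (hx : ‖T x‖ = ‖x‖) :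
    ContinuousLinearMap.adjoint T (T x) = x := by
  have h1 : ‖ContinuousLinearMap.adjoint T (T x)‖ ≤ ‖x‖ := by
    rw [← hx, ← one_mul ‖T x‖]
    exact ContinuousLinearMap.le_of_opNorm_le _ (by simpa using hT) _
  have h2 := norm_sub_sq (𝕜 := ℂ) (ContinuousLinearMap.adjoint T (T x)) x
  rw [ContinuousLinearMap.adjoint_inner_left, inner_self_eq_norm_sq, hx] at h2
  have h3 : ‖ContinuousLinearMap.adjoint T (T x) - x‖ = 0 := by
    nlinarith [norm_nonneg (ContinuousLinearMap.adjoint T (T x)),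
      norm_nonneg (ContinuousLinearMap.adjoint T (T x) - x)]
  exact sub_eq_zero.1 (norm_eq_zero.1 h3)

theorem IsUnitaryOn.adjoint_apply_apply {M : Submodule ℂ H} (hM : IsUnitaryOn T M) (hT : ‖T‖ ≤ 1)
    {x : H} (hx : x ∈ M) : ContinuousLinearMap.adjoint T (T x) = x :=
  adjoint_apply_self_of_norm_eq hT (hM.norm_map x hx)

theorem IsUnitaryOn.apply_adjoint_apply {M : Submodule ℂ H} (hM : IsUnitaryOn T M) (hT : ‖T‖ ≤ 1)
    {x : H} (hx : x ∈ M) : T (ContinuousLinearMap.adjoint T x) = x := by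
  obtain ⟨y, hy, rfl⟩ := hM.surj x hx
  rw [hM.adjoint_apply_apply hT hy]

/-- A reducing subspace on which the adjoint is a two-sided inverse is a unitary part. -/
theorem IsReducing.isUnitaryOn {M : Submodule ℂ H} (hM : IsReducing T M)
    (h1 : ∀ x ∈ M, ContinuousLinearMap.adjoint T (T x) = x)
    (h2 : ∀ x ∈ M, T (ContinuousLinearMap.adjoint T x) = x) : IsUnitaryOn T M where
  map_mem := hM.map_mem
  norm_map x hx := by
    rw [← sq_eq_sq₀ (norm_nonneg _) (norm_nonneg _), ← inner_self_eq_norm_sq (𝕜 := ℂ),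
      ← inner_self_eq_norm_sq (𝕜 := ℂ), ← ContinuousLinearMap.adjoint_inner_left, h1 x hx]
  surj y hy := ⟨_, hM.adjoint_mem y hy, h2 y hy⟩

variable (T) in
/-- The vectors whose norm is preserved by all powers of `T` and of its adjoint. -/
def IsNormPreserved (x : H) : Prop :=
  ∀ n : ℕ, ‖T^[n] x‖ = ‖x‖ ∧ ‖(ContinuousLinearMap.adjoint T)^[n] x‖ = ‖x‖

theorem IsNormPreserved.adjoint {x : H} (h : IsNormPreserved T x) :
    IsNormPreserved (ContinuousLinearMap.adjoint T) x := fun n => by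
  simpa using (h n).symm

theorem IsNormPreserved.norm_map {x : H} (h : IsNormPreserved T x) : ‖T x‖ = ‖x‖ := (h 1).1

/-- Powers of `T*` cause no trouble because `T* T x = x` cancels one factor. -/
theorem IsNormPreserved.map (hT : ‖T‖ ≤ 1) {x : H} (h : IsNormPreserved T x) :
    IsNormPreserved T (T x) := fun n => by
  rw [h.norm_map]
  refine ⟨(h (n + 1)).1, ?_⟩
  cases n with
  | zero => exact h.norm_map
  | succ n =>
    rw [Function.iterate_succ_apply, adjoint_apply_self_of_norm_eq hT h.norm_map, (h n).2]

omit [CompleteSpace H] in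
theorem IsUnitaryOn.iterate_mem {M : Submodule ℂ H} (hM : IsUnitaryOn T M) {x : H} (hx : x ∈ M)
    (n : ℕ) : T^[n] x ∈ M ∧ ‖T^[n] x‖ = ‖x‖ := by
  induction n with
  | zero => exact ⟨hx, rfl⟩
  | succ n ih =>
    rw [Function.iterate_succ_apply']
    exact ⟨hM.map_mem _ ih.1, (hM.norm_map _ ih.1).trans ih.2⟩

theorem IsReducing.adjoint {M : Submodule ℂ H} (hM : IsReducing T M) :
    IsReducing (ContinuousLinearMap.adjoint T) M :=
  ⟨hM.isClosed, hM.adjoint_mem, by simpa using hM.map_mem⟩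

theorem IsUnitaryOn.adjoint {M : Submodule ℂ H} (hM : IsUnitaryOn T M) (hr : IsReducing T M)
    (hT : ‖T‖ ≤ 1) : IsUnitaryOn (ContinuousLinearMap.adjoint T) M :=
  hr.adjoint.isUnitaryOn (by simpa using fun x hx => hM.apply_adjoint_apply hT hx)
    (by simpa using fun x hx => hM.adjoint_apply_apply hT hx)

theorem IsUnitaryOn.isNormPreserved {M : Submodule ℂ H} (hM : IsUnitaryOn T M)
    (hr : IsReducing T M) (hT : ‖T‖ ≤ 1) {x : H} (hx : x ∈ M) : IsNormPreserved T x := fun n =>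
  ⟨(hM.iterate_mem hx n).2, ((hM.adjoint hr hT).iterate_mem hx n).2⟩

/-- Equality of norms becomes membership in a kernel, so the norm-preserved vectors form a closed
subspace. -/
theorem norm_pow_apply_eq_iff (hT : ‖T‖ ≤ 1) (n : ℕ) (x : H) :
    ‖T^[n] x‖ = ‖x‖ ↔ (ContinuousLinearMap.adjoint (T ^ n) ∘L T ^ n - 1) x = 0 := by
  have hn : ‖T ^ n‖ ≤ 1 := by
    induction n with
    | zero => exact ContinuousLinearMap.norm_id_le
    | succ n ih =>
      rw [pow_succ]
      exact (norm_mul_le _ _).trans (mul_le_one₀ ih (norm_nonneg _) hT)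
  rw [sub_apply, sub_eq_zero, ← FunLike.coe_pow_eq_iterate T n]
  refine ⟨fun h => adjoint_apply_self_of_norm_eq hn h, fun h => ?_⟩
  rw [← sq_eq_sq₀ (norm_nonneg _) (norm_nonneg _), ← inner_self_eq_norm_sq (𝕜 := ℂ),
    ← inner_self_eq_norm_sq (𝕜 := ℂ), ← ContinuousLinearMap.adjoint_inner_left]
  exact congrArg (fun y => RCLike.re (inner ℂ y x)) h

/-- The largest reducing subspace on which the contraction `T` is unitary. -/
theorem exists_isUnitarySpace (hT : ‖T‖ ≤ 1) :
    ∃ M : Submodule ℂ H, IsUnitarySpace T M ∧ ∀ x, x ∈ M ↔ IsNormPreserved T x := by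
  have hT' : ‖ContinuousLinearMap.adjoint T‖ ≤ 1 := by simpa using hT
  let K : ℕ → (H →L[ℂ] H) → Submodule ℂ H := fun n S =>
    (ContinuousLinearMap.adjoint (S ^ n) ∘L S ^ n - 1).ker
  let M : Submodule ℂ H := ⨅ n, K n T ⊓ K n (ContinuousLinearMap.adjoint T)
  have hmem : ∀ x, x ∈ M ↔ IsNormPreserved T x := fun x => by
    simp only [M, K, Submodule.mem_iInf, Submodule.mem_inf, IsNormPreserved,
      norm_pow_apply_eq_iff hT, norm_pow_apply_eq_iff hT']
    rfl
  have hcl : IsClosed (M : Set H) := by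
    simp only [M, Submodule.coe_iInf, Submodule.coe_inf]
    exact isClosed_iInter fun n => (ContinuousLinearMap.isClosed_ker _).inter
      (ContinuousLinearMap.isClosed_ker _)
  have hred : IsReducing T M :=
    ⟨hcl, fun x hx => (hmem _).2 (((hmem x).1 hx).map hT), fun x hx => (hmem _).2 (by
      simpa using (((hmem x).1 hx).adjoint.map hT').adjoint)⟩
  refine ⟨M, ⟨⟨hred, hred.isUnitaryOn (fun x hx => ?_) fun x hx => ?_⟩, ?_⟩, hmem⟩
  · exact adjoint_apply_self_of_norm_eq hT ((hmem x).1 hx).norm_map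
  · simpa using adjoint_apply_self_of_norm_eq hT' ((hmem x).1 hx).adjoint.norm_map
  · exact fun N hN x hx => (hmem x).2 (hN.2.isNormPreserved hN.1 hT hx)

end UnitarySpace

/-! ### Wold decomposition of an invariant subspace -/

section Wold

variable {H : Type u} [NormedAddCommGroup H] [InnerProductSpace ℂ H] [CompleteSpace H]
  {T : H →L[ℂ] H} {M : Submodule ℂ H} {s : ℕ → H →ₗᵢ[ℂ] H}

/-- The wandering subspace `M ⊖ SM` of an isometry `S` on an invariant subspace `M`. -/
noncomputable def wandering (S : H →ₗᵢ[ℂ] H) (M : Submodule ℂ H) : Submodule ℂ H :=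
  M ⊓ (M.map S.toLinearMap)ᗮ

omit [CompleteSpace H] in
theorem isClosed_wandering (S : H →ₗᵢ[ℂ] H) (hM : IsClosed (M : Set H)) :
    IsClosed (wandering S M : Set H) :=
  hM.inter (Submodule.isClosed_orthogonal _)

omit [CompleteSpace H] in
theorem inner_map_of_mem_wandering {S : H →ₗᵢ[ℂ] H} {w m : H} (hw : w ∈ wandering S M)
    (hm : m ∈ M) : inner ℂ (S m) w = 0 :=
  (Submodule.mem_orthogonal _ _).1 hw.2 _ (Submodule.mem_map_of_mem hm)

/-- Commutation of `T*` with `S` makes `T` preserve orthogonality to `S M`, and vice versa. -/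
theorem IsReducing.wandering (hM : IsReducing T M) {S : H →ₗᵢ[ℂ] H}
    (h1 : ∀ x ∈ M, T (S x) = S (T x))
    (h2 : ∀ x ∈ M, ContinuousLinearMap.adjoint T (S x) = S (ContinuousLinearMap.adjoint T x)) :
    IsReducing T (wandering S M) where
  isClosed := isClosed_wandering S hM.isClosed
  map_mem w hw := by
    refine ⟨hM.map_mem w hw.1, (Submodule.mem_orthogonal _ _).2 ?_⟩
    rintro _ ⟨m, hm, rfl⟩
    rw [← ContinuousLinearMap.adjoint_inner_left]
    exact (congrArg (fun y => inner ℂ y w) (h2 m hm)).trans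
      (inner_map_of_mem_wandering hw (hM.adjoint_mem m hm))
  adjoint_mem w hw := by
    refine ⟨hM.adjoint_mem w hw.1, (Submodule.mem_orthogonal _ _).2 ?_⟩
    rintro _ ⟨m, hm, rfl⟩
    rw [ContinuousLinearMap.adjoint_inner_right]
    exact (congrArg (fun y => inner ℂ y w) (h1 m hm)).trans
      (inner_map_of_mem_wandering hw (hM.map_mem m hm))

/-- Project `y` onto `S M`, which is complete as an isometric image. The remainder lies in the
wandering subspace and is orthogonal to `y`, hence to itself. -/
theorem mem_map_of_orthogonal_wandering (hM : IsClosed (M : Set H)) {S : H →ₗᵢ[ℂ] H}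
    (hS : ∀ x ∈ M, S x ∈ M) {y : H} (hy : y ∈ M) (h : ∀ w ∈ wandering S M, inner ℂ w y = 0) :
    ∃ x ∈ M, S x = y := by
  set N := M.map S.toLinearMap
  have : CompleteSpace N := by
    have hc : IsComplete (S '' (M : Set H)) :=
      S.isometry.isUniformInducing.isComplete_iff.2 hM.isComplete
    exact completeSpace_coe_iff_isComplete.2 hc
  have hNM : N ≤ M := by
    rintro _ ⟨x, hx, rfl⟩
    exact hS x hx
  obtain ⟨p, hp, q, hq, hpq⟩ := N.exists_add_mem_mem_orthogonal y
  have hqW : q ∈ wandering S M := ⟨by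
    rw [← add_sub_cancel_left p q, ← hpq]
    exact M.sub_mem hy (hNM hp), hq⟩
  have h0 := h q hqW
  rw [hpq, inner_add_right, (Submodule.mem_orthogonal' _ _).1 hq p hp, zero_add,
    inner_self_eq_zero] at h0
  rw [h0, add_zero] at hpq
  obtain ⟨x, hx, rfl⟩ := hp
  exact ⟨x, hx, hpq.symm⟩

variable {F : Type*} [NormedAddCommGroup F] [InnerProductSpace ℂ F]

/-- The embedding `w ↦ S (j w)` into a subspace `M` that contains the range of `j` and is
invariant under `S`. -/
def mapInto (j : F →ₗᵢ[ℂ] H) (hj : ∀ w, j w ∈ M) (S : H →ₗᵢ[ℂ] H) (hS : ∀ x ∈ M, S x ∈ M) :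
    F →ₗᵢ[ℂ] M where
  toFun w := ⟨S (j w), hS _ (hj w)⟩
  map_add' v w := Subtype.ext (by simp)
  map_smul' c w := Subtype.ext (by simp)
  norm_map' w := (S.norm_map (j w)).trans (j.norm_map w)

theorem isHilbertSum_mapInto [CompleteSpace F] {j : F →ₗᵢ[ℂ] H}
    (hj : LinearMap.range j.toLinearMap = wandering (s 1) M) (hjM : ∀ w, j w ∈ M)
    (hM : IsClosed (M : Set H)) (hsM : ∀ k, ∀ x ∈ M, s k x ∈ M)
    (h0 : ∀ x, s 0 x = x) (hadd : ∀ j k x, s j (s k x) = s (j + k) x)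
    (hpure : ∀ x ∈ M, (∀ k, ∃ y, s k y = x) → x = 0) :
    IsHilbertSum ℂ (fun _ : ℕ => F) (fun k => mapInto j hjM (s k) (hsM k)) := by
  have hjW : ∀ w, j w ∈ wandering (s 1) M := fun w => hj ▸ ⟨w, rfl⟩
  have horth : ∀ i k, i < k → ∀ v w, inner ℂ (s k (j v)) (s i (j w)) = 0 := by
    intro i k hik v w
    -- With `k = i + d + 1`, cancelling `s i` leaves a vector of `S M` against a wandering one.
    obtain ⟨d, rfl⟩ := Nat.exists_eq_add_of_lt hik
    rw [add_assoc, ← hadd, LinearIsometry.inner_map_map, add_comm, ← hadd]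
    exact inner_map_of_mem_wandering (hjW w) (hsM d _ (hjM v))
  refine IsHilbertSum.mk ?_ ?_
  · intro i k hik v w
    change inner ℂ (s i (j v)) (s k (j w)) = 0
    rcases lt_or_gt_of_ne hik with h | h
    · exact inner_eq_zero_symm.1 (horth i k h w v)
    · exact horth k i h v w
  · have : CompleteSpace M := hM.completeSpace_coe
    rw [top_le_iff, Submodule.topologicalClosure_eq_top_iff, Submodule.eq_bot_iff]
    rintro x hx
    have hx' : ∀ k, ∀ w ∈ wandering (s 1) M, inner ℂ (s k w) (x : H) = 0 := by
      rw [← hj]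
      rintro k _ ⟨w, rfl⟩
      exact (Submodule.mem_orthogonal _ _).1 hx _ (Submodule.mem_iSup_of_mem k ⟨w, rfl⟩)
    -- A vector orthogonal to all `S^k W` can be divided by `S` again and again inside `M`, so
    -- purity kills it.
    refine Subtype.ext (hpure x x.2 fun k => ?_)
    suffices ∃ y ∈ M, s k y = x from this.imp fun _ h => h.2
    induction k with
    | zero => exact ⟨x, x.2, h0 x⟩
    | succ k ih =>
      obtain ⟨y, hy, hyx⟩ := ih
      obtain ⟨z, hz, rfl⟩ := mem_map_of_orthogonal_wandering hM (hsM 1) hy fun w hw => by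
        rw [← (s k).inner_map_map, hyx]
        exact hx' k w hw
      exact ⟨z, hz, by rw [← hyx, hadd]⟩

/-- A Hilbert sum of copies of the wandering subspace is isometric to the invariant subspace. -/
theorem exists_equiv_of_isHilbertSum [CompleteSpace F] {j : F →ₗᵢ[ℂ] H}
    (hj : LinearMap.range j.toLinearMap = wandering (s 1) M)
    (hM : IsClosed (M : Set H)) (hsM : ∀ k, ∀ x ∈ M, s k x ∈ M)
    (h0 : ∀ x, s 0 x = x) (hadd : ∀ j k x, s j (s k x) = s (j + k) x)
    (hpure : ∀ x ∈ M, (∀ k, ∃ y, s k y = x) → x = 0)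
    {A : Type*} [NormedAddCommGroup A] [InnerProductSpace ℂ A] [CompleteSpace A]
    {m : ℕ → F →ₗᵢ[ℂ] A} (hm : IsHilbertSum ℂ (fun _ : ℕ => F) m) :
    ∃ V : A ≃ₗᵢ[ℂ] M, ∀ k w, (V (m k w) : H) = s k (j w) := by
  have : CompleteSpace M := hM.completeSpace_coe
  have hjM : ∀ w, j w ∈ M := fun w => (hj.le ⟨w, rfl⟩).1
  have hsum := isHilbertSum_mapInto hj hjM hM hsM h0 hadd hpure
  refine ⟨hm.linearIsometryEquiv.trans hsum.linearIsometryEquiv.symm, fun k w => ?_⟩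
  have h1 : hm.linearIsometryEquiv (m k w) = lp.single 2 k w := by
    rw [← hm.linearIsometryEquiv_symm_apply_single, LinearIsometryEquiv.apply_symm_apply]
  rw [LinearIsometryEquiv.trans_apply, h1, hsum.linearIsometryEquiv_symm_apply_single]
  rfl

/-- If nothing wanders then `S M = M`, so every vector of `M` is infinitely divisible by `S`. -/
theorem wandering_ne_bot (hM : IsClosed (M : Set H)) (hsM : ∀ k, ∀ x ∈ M, s k x ∈ M)
    (h0 : ∀ x, s 0 x = x) (hadd : ∀ j k x, s j (s k x) = s (j + k) x)
    (hpure : ∀ x ∈ M, (∀ k, ∃ y, s k y = x) → x = 0)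
    (hne : M ≠ ⊥) : wandering (s 1) M ≠ ⊥ := by
  intro hW
  refine hne ((Submodule.eq_bot_iff _).2 fun x hx => hpure x hx fun k => ?_)
  suffices ∃ y ∈ M, s k y = x from this.imp fun _ h => h.2
  induction k with
  | zero => exact ⟨x, hx, h0 x⟩
  | succ k ih =>
    obtain ⟨y, hy, hyx⟩ := ih
    obtain ⟨z, hz, rfl⟩ := mem_map_of_orthogonal_wandering hM (hsM 1) hy fun w hw => by
      rw [hW, Submodule.mem_bot] at hw
      rw [hw, inner_zero_left]
    exact ⟨z, hz, by rw [← hyx, hadd]⟩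

/-- A contraction is modelled by a unitary operator on each reducing subspace on which it is
unitary. -/
theorem IsUnitaryOn.exists_unitary {W : Submodule ℂ H} (hT : ‖T‖ ≤ 1)
    (hr : IsReducing T W) (hu : IsUnitaryOn T W) :
    ∃ (F : Type u) (_ : NormedAddCommGroup F) (_ : InnerProductSpace ℂ F) (_ : CompleteSpace F)
      (j : F →ₗᵢ[ℂ] H) (U : F →L[ℂ] F), LinearMap.range j.toLinearMap = W ∧
      U ∈ unitary (F →L[ℂ] F) ∧ (∀ w, j (U w) = T (j w)) ∧
      ∀ w, j (ContinuousLinearMap.adjoint U w) = ContinuousLinearMap.adjoint T (j w) := by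
  have : CompleteSpace W := hr.isClosed.completeSpace_coe
  let U : W →L[ℂ] W := (T ∘L W.subtypeL).codRestrict W fun w => hr.map_mem w w.2
  let U' : W →L[ℂ] W :=
    (ContinuousLinearMap.adjoint T ∘L W.subtypeL).codRestrict W fun w => hr.adjoint_mem w w.2
  have h : U' = ContinuousLinearMap.adjoint U :=
    (ContinuousLinearMap.eq_adjoint_iff _ _).2 fun x y =>
      ContinuousLinearMap.adjoint_inner_left T (y : H) (x : H)
  refine ⟨W, inferInstance, inferInstance, inferInstance, W.subtypeₗᵢ, U, W.range_subtype, ?_,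
    fun _ => rfl, fun w => by rw [← h]; rfl⟩
  rw [Unitary.mem_iff, ContinuousLinearMap.star_eq_adjoint, ← h]
  exact ⟨ContinuousLinearMap.ext fun w => Subtype.ext (hu.adjoint_apply_apply hT w.2),
    ContinuousLinearMap.ext fun w => Subtype.ext (hu.apply_adjoint_apply hT w.2)⟩

end Wold

/-! ### The Hardy space as a Hilbert sum of monomials -/

section HardySum

variable {F : Type u} [NormedAddCommGroup F] [InnerProductSpace ℂ F] [CompleteSpace F]

/-- The embedding `w ↦ e_k w` of `F` into `H²_F(𝔻)`. -/
noncomputable def monomial (k : ℕ) : F →ₗᵢ[ℂ] Hardy F where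
  toFun w := ⟨charMul (k : ℤ) (constL2 w), fun n hn => by
    rw [fourierCoeff_charMul_constL2, if_neg (by lia)]⟩
  map_add' v w := Subtype.ext (by simp)
  map_smul' c w := Subtype.ext (by simp)
  norm_map' w := by
    change ‖charMul (k : ℤ) (constL2 w)‖ = ‖w‖
    simp

theorem coe_monomial (k : ℕ) (w : F) : (monomial k w : L2 F) = charMul (k : ℤ) (constL2 w) := rfl

theorem isHilbertSum_monomial :
    IsHilbertSum ℂ (fun _ : ℕ => F) (fun k => (monomial k : F →ₗᵢ[ℂ] Hardy F)) := by
  refine IsHilbertSum.mk ?_ ?_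
  · intro j k hjk v w
    change inner ℂ (charMul (j : ℤ) (constL2 v)) (charMul (k : ℤ) (constL2 w)) = 0
    rw [inner_charMul_constL2, fourierCoeff_charMul_constL2, if_neg (by exact_mod_cast hjk),
      inner_zero_right]
  · rw [top_le_iff, Submodule.topologicalClosure_eq_top_iff, Submodule.eq_bot_iff]
    rintro f hf
    refine Subtype.ext (L2.eq_zero_of_fourierCoeff fun n => ?_)
    rcases lt_or_ge n 0 with hn | hn
    · exact f.2 n hn
    · lift n to ℕ using hn
      have h := (Submodule.mem_orthogonal _ _).1 hf _
        (Submodule.mem_iSup_of_mem n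
          ⟨fourierCoeff ((f : L2 F) : UnitAddCircle → F) (n : ℤ), rfl⟩)
      have h' := (inner_charMul_constL2 (n : ℤ) _ (f : L2 F)).symm.trans h
      exact inner_self_eq_zero.1 h'

/-- Monomials span a dense subspace of `H²`. -/
theorem hardy_ext {G : Type*} [NormedAddCommGroup G] [NormedSpace ℂ G]
    {A B : Hardy F →L[ℂ] G} (h : ∀ k w, A (monomial k w) = B (monomial k w)) : A = B := by
  have htop : (⊤ : Submodule ℂ (Hardy F)) ≤ (A - B).ker := by
    have hd := (isHilbertSum_monomial (F := F)).OrthogonalFamily.range_linearIsometry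
    rw [LinearMap.range_eq_top.2 (isHilbertSum_monomial (F := F)).surjective_isometry] at hd
    rw [hd]
    refine Submodule.topologicalClosure_minimal _ (iSup_le fun k => ?_) (A - B).isClosed_ker
    rintro _ ⟨w, rfl⟩
    change (A - B) (monomial k w) = 0
    rw [sub_apply, h, sub_self]
  ext f
  exact sub_eq_zero.1 (htop (Submodule.mem_top (x := f)))

theorem toeplitz_const_monomial (U : F →L[ℂ] F) (k : ℕ) (w : F) :
    toeplitz (fun _ => U) (MemLInfty.const U) (monomial k w) = monomial k (U w) := by
  have h : laurent (fun _ => U) (MemLInfty.const U) (monomial k w : L2 F) = monomial k (U w) := by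
    rw [coe_monomial, coe_monomial, laurent_charMul]
    congr 1
    refine Lp.ext ?_
    filter_upwards [laurent_apply_ae (MemLInfty.const U) (constL2 w), constL2_ae w,
      constL2_ae (U w)] with t h1 h2 h3
    rw [h1, h2, h3]
  refine Subtype.ext ?_
  rw [coe_toeplitz_of_mem _ (h ▸ (monomial k (U w)).2), h]

end HardySum

/-! ### Shift invariance of the unitary space of a Toeplitz contraction -/

section UnitarySpace

variable {E : Type u} [NormedAddCommGroup E] [InnerProductSpace ℂ E] [CompleteSpace E]
  {Φ : UnitAddCircle → E →L[ℂ] E}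

theorem IsNormPreserved.iterate {H : Type u} [NormedAddCommGroup H] [InnerProductSpace ℂ H]
    [CompleteSpace H] {T : H →L[ℂ] H} (hT : ‖T‖ ≤ 1) {x : H} (h : IsNormPreserved T x) (n : ℕ) :
    IsNormPreserved T (T^[n] x) := by
  induction n with
  | zero => exact h
  | succ n ih =>
    rw [Function.iterate_succ_apply']
    exact ih.map hT

theorem toeplitz_hardyMul_of_norm_eq (hΦ : MemLInfty Φ) (hT : ‖toeplitz Φ hΦ‖ ≤ 1)
    {f : Hardy E} (hf : ‖toeplitz Φ hΦ f‖ = ‖f‖) (k : ℕ) :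
    toeplitz Φ hΦ (hardyMul k f) = hardyMul k (toeplitz Φ hΦ f) :=
  toeplitz_hardyMul_of_mem hΦ (laurent_mem_hardy_of_norm_eq hΦ hT hf) k

theorem norm_iterate_toeplitz_hardyMul (hΦ : MemLInfty Φ) (hT : ‖toeplitz Φ hΦ‖ ≤ 1)
    {f : Hardy E} (hf : IsNormPreserved (toeplitz Φ hΦ) f) (k n : ℕ) :
    ‖(toeplitz Φ hΦ)^[n] (hardyMul k f)‖ = ‖hardyMul k f‖ := by
  have h : (toeplitz Φ hΦ)^[n] (hardyMul k f) = hardyMul k ((toeplitz Φ hΦ)^[n] f) := by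
    induction n with
    | zero => rfl
    | succ n ih =>
      rw [Function.iterate_succ_apply', Function.iterate_succ_apply', ih,
        toeplitz_hardyMul_of_norm_eq hΦ hT (hf.iterate hT n).norm_map]
  rw [h, LinearIsometry.norm_map, LinearIsometry.norm_map, (hf n).1]

/-- The half about powers of `T*` is the half about `T` applied to the symbol `Φ*`. -/
theorem IsNormPreserved.hardyMul (hΦ : MemLInfty Φ) (hT : ‖toeplitz Φ hΦ‖ ≤ 1)
    {f : Hardy E} (hf : IsNormPreserved (toeplitz Φ hΦ) f) (k : ℕ) :
    IsNormPreserved (toeplitz Φ hΦ) (hardyMul k f) := fun n => by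
  refine ⟨norm_iterate_toeplitz_hardyMul hΦ hT hf k n, ?_⟩
  have h := hf.adjoint
  have hT' : ‖ContinuousLinearMap.adjoint (toeplitz Φ hΦ)‖ ≤ 1 := by
    rwa [LinearIsometryEquiv.norm_map]
  rw [adjoint_toeplitz] at h hT' ⊢
  exact norm_iterate_toeplitz_hardyMul hΦ.adjoint hT' h k n

/-- The structure of the unitary space of a contractive Toeplitz operator: it is invariant under
the shift, and its wandering subspace reduces the operator. -/
theorem exists_isUnitarySpace_toeplitz (hΦ : MemLInfty Φ) (hT : ‖toeplitz Φ hΦ‖ ≤ 1) :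
    ∃ M : Submodule ℂ (Hardy E), IsUnitarySpace (toeplitz Φ hΦ) M ∧
      (∀ k, ∀ f ∈ M, hardyMul k f ∈ M) ∧
      (∀ k, ∀ f ∈ M, toeplitz Φ hΦ (hardyMul k f) = hardyMul k (toeplitz Φ hΦ f)) ∧
      (∀ k, ∀ f ∈ M, ContinuousLinearMap.adjoint (toeplitz Φ hΦ) (hardyMul k f) =
        hardyMul k (ContinuousLinearMap.adjoint (toeplitz Φ hΦ) f)) ∧
      (∀ f ∈ M, laurent Φ hΦ f = (toeplitz Φ hΦ f : L2 E)) ∧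
      (∀ f ∈ M, laurent _ hΦ.adjoint f =
        (ContinuousLinearMap.adjoint (toeplitz Φ hΦ) f : L2 E)) := by
  obtain ⟨M, hM, hmem⟩ := exists_isUnitarySpace hT
  have hT' : ‖ContinuousLinearMap.adjoint (toeplitz Φ hΦ)‖ ≤ 1 := by
    rwa [LinearIsometryEquiv.norm_map]
  have hadj : ∀ f ∈ M, ‖ContinuousLinearMap.adjoint (toeplitz Φ hΦ) f‖ = ‖f‖ := fun f hf =>
    ((hmem f).1 hf).adjoint.norm_map
  refine ⟨M, hM, fun k f hf => (hmem _).2 (((hmem f).1 hf).hardyMul hΦ hT k),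
    fun k f hf => toeplitz_hardyMul_of_norm_eq hΦ hT ((hmem f).1 hf).norm_map k, ?_,
    fun f hf => (coe_toeplitz_of_mem hΦ
      (laurent_mem_hardy_of_norm_eq hΦ hT ((hmem f).1 hf).norm_map)).symm, ?_⟩
  · intro k f hf
    have h := hadj f hf
    rw [adjoint_toeplitz] at h hT' ⊢
    exact toeplitz_hardyMul_of_norm_eq hΦ.adjoint hT' h k
  · intro f hf
    have h := hadj f hf
    rw [adjoint_toeplitz] at h hT' ⊢
    exact (coe_toeplitz_of_mem hΦ.adjoint
      (laurent_mem_hardy_of_norm_eq hΦ.adjoint hT' h)).symm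

end UnitarySpace

/-! ### The Poisson kernel -/

section Poisson

variable {E : Type*} [NormedAddCommGroup E] [NormedSpace ℂ E]

theorem fourier_mul_natCast (k : ℤ) (n : ℕ) (t : UnitAddCircle) :
    fourier (k * n) t = fourier k t ^ n := by
  induction n with
  | zero => simp
  | succ n ih => rw [Nat.cast_succ, mul_add, mul_one, fourier_add, ih, pow_succ]

theorem norm_mul_fourier (z : ℂ) (k : ℤ) (t : UnitAddCircle) : ‖z * fourier k t‖ = ‖z‖ := by
  rw [norm_mul, norm_fourier_apply, mul_one]

theorem integrable_geometric_smul {f : UnitAddCircle → E} (hf : Integrable f haarAddCircle)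
    {z : ℂ} (hz : ‖z‖ < 1) (k : ℤ) :
    Integrable (fun t => (1 - z * fourier k t)⁻¹ • f t) haarAddCircle := by
  have h1 : ∀ t : UnitAddCircle, 1 - ‖z‖ ≤ ‖1 - z * fourier k t‖ := fun t => by
    have := norm_sub_norm_le (1 : ℂ) (z * fourier k t)
    rwa [norm_one, norm_mul_fourier] at this
  refine hf.bdd_smul (1 - ‖z‖)⁻¹ (Continuous.aestronglyMeasurable ?_)
    (Filter.Eventually.of_forall fun t => ?_)
  · refine Continuous.inv₀ (by fun_prop) fun t => norm_pos_iff.1 ?_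
    exact (sub_pos.2 hz).trans_le (h1 t)
  · rw [norm_inv]
    exact inv_anti₀ (sub_pos.2 hz) (h1 t)

/-- Integrate a geometric series termwise. Taking `k = 1` gives the analytic part of the Poisson
integral, `k = -1` the antianalytic part. -/
theorem hasSum_pow_smul_fourierCoeff {f : UnitAddCircle → E} (hf : Integrable f haarAddCircle)
    {z : ℂ} (hz : ‖z‖ < 1) (k : ℤ) :
    HasSum (fun n : ℕ => z ^ n • fourierCoeff f (k * n))
      (∫ t, (1 - z * fourier (-k) t)⁻¹ • f t ∂haarAddCircle) := by
  have hint : ∀ n : ℕ, Integrable (fun t => (z * fourier (-k) t) ^ n • f t) haarAddCircle :=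
    fun n => hf.bdd_smul 1 (Continuous.aestronglyMeasurable (by fun_prop))
      (Filter.Eventually.of_forall fun t => by
        rw [norm_pow, norm_mul_fourier]
        exact pow_le_one₀ (norm_nonneg _) hz.le)
  have hnorm : ∀ n : ℕ, ∫ t, ‖(z * fourier (-k) t) ^ n • f t‖ ∂haarAddCircle =
      ‖z‖ ^ n * ∫ t, ‖f t‖ ∂haarAddCircle := fun n => by
    rw [← integral_const_mul]
    simp_rw [norm_smul, norm_pow, norm_mul_fourier]
  have h := hasSum_integral_of_summable_integral_norm hint (by
    simp_rw [hnorm]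
    exact (summable_geometric_of_lt_one (norm_nonneg _) hz).mul_right _)
  convert! h using 1
  · funext n
    rw [fourierCoeff, ← integral_smul]
    refine integral_congr_ae (Filter.Eventually.of_forall fun t => ?_)
    simp only
    rw [← neg_mul, fourier_mul_natCast, smul_smul, mul_pow]
  · refine integral_congr_ae (Filter.Eventually.of_forall fun t => ?_)
    have hq : ‖z * fourier (-k) t‖ < 1 := by rwa [norm_mul_fourier]
    exact ((hasSum_geometric_of_norm_lt_one hq).smul_const (f t)).tsum_eq.symm

theorem poisson_identity {q : ℂ} (hq : ‖q‖ < 1) :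
    (1 - q)⁻¹ + (1 - starRingEnd ℂ q)⁻¹ - 1 = ((1 - ‖q‖ ^ 2) / ‖1 - q‖ ^ 2 : ℝ) := by
  have h1 : 1 - q ≠ 0 := by
    intro h
    rw [← sub_eq_zero.1 h, norm_one] at hq
    exact lt_irrefl _ hq
  have h2 : 1 - starRingEnd ℂ q ≠ 0 := by
    have := (map_ne_zero (starRingEnd ℂ)).2 h1
    rwa [map_sub, map_one] at this
  push_cast
  rw [← Complex.mul_conj', ← Complex.mul_conj', map_sub, map_one]
  field_simp
  ring

/-- The Poisson kernel is the sum of two Cauchy kernels minus `1`. As negative coefficients vanish,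
the conjugate kernel contributes only the mean of `f`, which the `-1` cancels. -/
theorem integral_poisson_smul {f : UnitAddCircle → E} (hf : Integrable f haarAddCircle)
    (hneg : ∀ n : ℤ, n < 0 → fourierCoeff f n = 0) {z : ℂ} (hz : ‖z‖ < 1) :
    Integrable (fun t => ((1 - ‖z‖ ^ 2) / ‖1 - z * fourier (-1) t‖ ^ 2 : ℝ) • f t)
      haarAddCircle ∧
    HasSum (fun n : ℕ => z ^ n • fourierCoeff f (n : ℤ))
      (∫ t, ((1 - ‖z‖ ^ 2) / ‖1 - z * fourier (-1) t‖ ^ 2 : ℝ) • f t ∂haarAddCircle) := by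
  have hz' : ‖starRingEnd ℂ z‖ < 1 := by simpa using hz
  have hP : ∀ t, ((1 - ‖z‖ ^ 2) / ‖1 - z * fourier (-1) t‖ ^ 2 : ℝ) • f t =
      (1 - z * fourier (-1) t)⁻¹ • f t + (1 - starRingEnd ℂ z * fourier 1 t)⁻¹ • f t - f t := by
    intro t
    have hq : ‖z * fourier (-1) t‖ < 1 := by rwa [norm_mul_fourier]
    have h := poisson_identity hq
    rw [norm_mul_fourier, map_mul, fourier_neg, Complex.conj_conj] at h
    rw [fourier_neg, ← Complex.coe_smul, ← h, sub_smul, add_smul, one_smul]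
  have i1 := integrable_geometric_smul hf hz (-1)
  have i2 := integrable_geometric_smul hf hz' 1
  have h1 := hasSum_pow_smul_fourierCoeff hf hz 1
  have h2 := hasSum_pow_smul_fourierCoeff hf hz' (-1)
  have h3 : ∫ t, (1 - starRingEnd ℂ z * fourier 1 t)⁻¹ • f t ∂haarAddCircle =
      ∫ t, f t ∂haarAddCircle := by
    rw [neg_neg] at h2
    refine h2.unique ?_
    convert! hasSum_single (f := fun n : ℕ => starRingEnd ℂ z ^ n • fourierCoeff f (-1 * n)) 0
      fun n hn => ?_ using 1
    · simp [fourierCoeff]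
    · rw [hneg _ (by lia), smul_zero]
  simp_rw [hP]
  refine ⟨(i1.add i2).sub hf, ?_⟩
  have h4 := integral_sub (i1.add i2) hf
  simp only [Pi.add_apply] at h4
  rw [h4, integral_add i1 i2, h3, add_sub_cancel_right]
  simpa using h1

/-- The power series of a bounded function with vanishing negative Fourier coefficients is bounded
on the disc by the same constant. -/
theorem norm_le_of_hasSum_pow_smul_fourierCoeff {f : UnitAddCircle → E}
    (hf : Integrable f haarAddCircle) (hneg : ∀ n : ℤ, n < 0 → fourierCoeff f n = 0) {C : ℝ}
    (hC : ∀ᵐ t ∂haarAddCircle, ‖f t‖ ≤ C) {z : ℂ} (hz : ‖z‖ < 1) {y : E}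
    (hy : HasSum (fun n : ℕ => z ^ n • fourierCoeff f (n : ℤ)) y) : ‖y‖ ≤ C := by
  obtain ⟨hi, hs⟩ := integral_poisson_smul hf hneg hz
  set P : UnitAddCircle → ℝ := fun t => (1 - ‖z‖ ^ 2) / ‖1 - z * fourier (-1) t‖ ^ 2 with hP
  have hP0 : ∀ t, 0 ≤ P t := fun t =>
    div_nonneg (sub_nonneg.2 (pow_le_one₀ (norm_nonneg _) hz.le)) (sq_nonneg _)
  -- The constant function `1` shows that the Poisson kernel has total mass one.
  obtain ⟨hi1, hs1⟩ := integral_poisson_smul (f := fun _ => (1 : ℂ)) (integrable_const _)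
    (fun n hn => by rw [fourierCoeff_const, if_neg hn.ne]) hz
  have hP1 : ∫ t, P t ∂haarAddCircle = 1 := by
    have h := hs1.unique (hasSum_single 0 fun n hn => by
      rw [fourierCoeff_const, if_neg (by exact_mod_cast hn), smul_zero])
    rw [integral_smul_const, fourierCoeff_const] at h
    simpa [Complex.real_smul, hP] using h
  have hPi : Integrable P haarAddCircle := by
    refine hi1.re.congr (Filter.Eventually.of_forall fun t => ?_)
    change RCLike.re (P t • (1 : ℂ)) = P t
    rw [Complex.real_smul, mul_one]
    exact Complex.ofReal_re _
  rw [hy.unique hs]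
  calc ‖∫ t, P t • f t ∂haarAddCircle‖ ≤ ∫ t, P t * C ∂haarAddCircle := by
        refine norm_integral_le_of_norm_le (hPi.mul_const C) ?_
        filter_upwards [hC] with t ht
        rw [norm_smul, Real.norm_of_nonneg (hP0 t)]
        exact mul_le_mul_of_nonneg_left ht (hP0 t)
    _ = C := by rw [integral_mul_const, hP1, one_mul]

end Poisson

/-! ### Inner functions from separable subspaces of a wandering subspace -/

section Separable

variable {H : Type u} [NormedAddCommGroup H] [InnerProductSpace ℂ H] [CompleteSpace H]
  {T : H →L[ℂ] H}

/-- Take the closed span of the orbit of one non-zero vector under all words in `T` and `T*`; there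
are countably many words. -/
theorem IsReducing.exists_separable {W : Submodule ℂ H} (hr : IsReducing T W)
    (hu : IsUnitaryOn T W) (hT : ‖T‖ ≤ 1) (hW : W ≠ ⊥) :
    ∃ F ≤ W, F ≠ ⊥ ∧ IsReducing T F ∧ IsUnitaryOn T F ∧
      TopologicalSpace.IsSeparable (F : Set H) := by
  obtain ⟨w, hwW, hw⟩ := Submodule.exists_mem_ne_zero_of_ne_bot hW
  let x : List Bool → H := List.foldr
    (fun b y => if b then T y else ContinuousLinearMap.adjoint T y) w
  set N := Submodule.span ℂ (Set.range x)
  set F := N.topologicalClosure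
  have hclosed : IsClosed (F : Set H) := N.isClosed_topologicalClosure
  have hxF : ∀ l, x l ∈ F := fun l =>
    N.le_topologicalClosure (Submodule.subset_span ⟨l, rfl⟩)
  have hinv : ∀ A : H →L[ℂ] H, (∀ l, A (x l) ∈ F) → ∀ y ∈ F, A y ∈ F := by
    intro A hA y hy
    have hle : F ≤ F.comap A.toLinearMap := by
      refine Submodule.topologicalClosure_minimal _ (Submodule.span_le.2 ?_)
        (hclosed.preimage A.continuous)
      rintro _ ⟨l, rfl⟩
      exact hA l
    exact hle hy
  have hred : IsReducing T F :=
    ⟨hclosed, hinv T fun l => hxF (true :: l), hinv _ fun l => hxF (false :: l)⟩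
  have hxW : ∀ l, x l ∈ W := by
    intro l
    induction l with
    | nil => exact hwW
    | cons b l ih =>
      cases b
      · exact hr.adjoint_mem _ ih
      · exact hr.map_mem _ ih
  have hFW : F ≤ W := Submodule.topologicalClosure_minimal _
    (Submodule.span_le.2 (by rintro _ ⟨l, rfl⟩; exact hxW l)) hr.isClosed
  refine ⟨F, hFW, ?_, hred, hred.isUnitaryOn
    (fun y hy => hu.adjoint_apply_apply hT (hFW hy))
    (fun y hy => hu.apply_adjoint_apply hT (hFW hy)), ?_⟩
  · exact fun h => hw ((Submodule.eq_bot_iff F).1 h w (hxF []))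
  · exact ((Set.countable_range x).isSeparable.span (R := ℂ)).closure

omit [CompleteSpace H] in
-- Distinct orthonormal vectors lie `√2` apart, so balls of radius `1/2` around them are disjoint.
theorem countable_of_orthonormal [TopologicalSpace.SeparableSpace H] {ι : Type*} {v : ι → H}
    (hv : Orthonormal ℂ v) : Countable ι := by
  refine Pairwise.countable_of_isOpen_disjoint (s := fun i => Metric.ball (v i) (1 / 2))
    (fun i j hij => ?_) (fun _ => Metric.isOpen_ball)
    (fun i => ⟨v i, Metric.mem_ball_self (by norm_num)⟩)
  refine Metric.ball_disjoint_ball ?_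
  have h := norm_sub_sq (𝕜 := ℂ) (v i) (v j)
  rw [hv.2 hij, hv.1 i, hv.1 j] at h
  rw [dist_eq_norm]
  norm_num at h
  nlinarith [norm_nonneg (v i - v j)]

end Separable

/-! ### Pointwise evaluation on a wandering subspace -/

section Boundary

theorem norm_le_one_of_isometry {F E : Type*} [NormedAddCommGroup F] [NormedSpace ℂ F]
    [NormedAddCommGroup E] [NormedSpace ℂ E] {B : F →L[ℂ] E} (hB : Isometry B) : ‖B‖ ≤ 1 :=
  B.opNorm_le_bound zero_le_one fun f => by
    rw [one_mul, hB.norm_map_of_map_zero (map_zero _)]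

variable {E : Type u} [NormedAddCommGroup E] [InnerProductSpace ℂ E] [CompleteSpace E]

variable {F : Type*} [NormedAddCommGroup F] [InnerProductSpace ℂ F]

/-- The submodule of vectors `f` for which the field of operators `B` evaluates `j f`
pointwise. -/
def evaluated (j : F →ₗᵢ[ℂ] Hardy E) (B : UnitAddCircle → F →L[ℂ] E) : Submodule ℂ F where
  carrier := {f | (fun t => B t f) =ᵐ[haarAddCircle] (j f : L2 E)}
  add_mem' {f g} hf hg := by
    have h := Lp.coeFn_add (j f : L2 E) (j g : L2 E)
    change _ =ᵐ[haarAddCircle] _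
    rw [map_add]
    filter_upwards [hf, hg, h] with t h1 h2 h3
    rw [map_add, h1, h2]
    exact h3.symm
  zero_mem' := by
    change _ =ᵐ[haarAddCircle] _
    rw [map_zero]
    filter_upwards [Lp.coeFn_zero E 2 (haarAddCircle : Measure UnitAddCircle)] with t h
    rw [map_zero]
    exact h.symm
  smul_mem' c f hf := by
    have h := Lp.coeFn_smul c (j f : L2 E)
    change _ =ᵐ[haarAddCircle] _
    rw [map_smul]
    filter_upwards [hf, h] with t h1 h3
    rw [map_smul, h1]
    exact h3.symm

omit [CompleteSpace E] in
-- Since `‖(j f) t‖ = ‖f‖` a.e., convergence in `F` forces pointwise convergence off one null set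
-- along the whole sequence.
theorem isClosed_evaluated {j : F →ₗᵢ[ℂ] Hardy E}
    (hj : ∀ f, ∀ᵐ t ∂haarAddCircle, ‖(j f : L2 E) t‖ = ‖f‖)
    {B : UnitAddCircle → F →L[ℂ] E} (hB : ∀ᵐ t ∂haarAddCircle, ‖B t‖ ≤ 1) :
    IsClosed (evaluated j B : Set F) := by
  refine isClosed_of_closure_subset fun f hf => ?_
  obtain ⟨g, hg, hlim⟩ := mem_closure_iff_seq_limit.1 hf
  have h1 : ∀ᵐ t ∂haarAddCircle, ∀ n, B t (g n) = (j (g n) : L2 E) t :=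
    ae_all_iff.2 hg
  have h2 : ∀ᵐ t ∂haarAddCircle, ∀ n,
      ‖(j (g n) : L2 E) t - (j f : L2 E) t‖ = ‖g n - f‖ :=
    ae_all_iff.2 fun n => by
      have h := Lp.coeFn_sub (j (g n) : L2 E) (j f : L2 E)
      have h' := hj (g n - f)
      rw [map_sub] at h'
      filter_upwards [h', h] with t h3 h4
      rw [← Pi.sub_apply, ← h4]
      exact h3
  change (fun t => B t f) =ᵐ[haarAddCircle] _
  filter_upwards [hB, h1, h2] with t hb h3 h4
  have l1 : Filter.Tendsto (fun n => B t (g n)) Filter.atTop (nhds (B t f)) :=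
    ((B t).continuous.tendsto f).comp hlim
  have l2 : Filter.Tendsto (fun n => B t (g n)) Filter.atTop (nhds ((j f : L2 E) t)) := by
    rw [tendsto_iff_norm_sub_tendsto_zero]
    simp_rw [h3, h4]
    exact tendsto_iff_norm_sub_tendsto_zero.1 hlim
  exact tendsto_nhds_unique l1 l2

/-- A separable Hilbert space of functions with constant pointwise inner products is evaluated
pointwise by a field of isometries. -/
theorem exists_isometry_field [CompleteSpace F] [TopologicalSpace.SeparableSpace F]
    {j : F →ₗᵢ[ℂ] Hardy E} (hj : ∀ f g, ∀ᵐ t ∂haarAddCircle,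
      inner ℂ ((j f : L2 E) t) ((j g : L2 E) t) = inner ℂ f g) :
    ∃ B : UnitAddCircle → F →L[ℂ] E, (∀ᵐ t ∂haarAddCircle, Isometry (B t)) ∧
      ∀ f, (fun t => B t f) =ᵐ[haarAddCircle] (j f : L2 E) := by
  classical
  obtain ⟨s, b, -⟩ := exists_hilbertBasis ℂ F
  have : Countable s := countable_of_orthonormal b.orthonormal
  have horth : ∀ᵐ t ∂haarAddCircle, Orthonormal ℂ fun i => (j (b i) : L2 E) t := by
    simp_rw [orthonormal_iff_ite]
    refine ae_all_iff.2 fun i => ae_all_iff.2 fun k => ?_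
    filter_upwards [hj (b i) (b k)] with t ht
    rw [ht]
    exact (orthonormal_iff_ite.1 b.orthonormal) i k
  -- Off a null set the values of the countable basis are orthonormal and define an isometry; the
  -- value `0` elsewhere is immaterial.
  let B : UnitAddCircle → F →L[ℂ] E := fun t =>
    if h : Orthonormal ℂ fun i => (j (b i) : L2 E) t then
      (h.orthogonalFamily.linearIsometry.comp b.repr.toLinearIsometry).toContinuousLinearMap
    else 0
  have hBiso : ∀ᵐ t ∂haarAddCircle, Isometry (B t) := by
    filter_upwards [horth] with t ht
    simp only [B, dif_pos ht]
    exact (ht.orthogonalFamily.linearIsometry.comp b.repr.toLinearIsometry).isometry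
  have hBb : ∀ i, b i ∈ evaluated j B := fun i => by
    change (fun t => B t (b i)) =ᵐ[haarAddCircle] _
    filter_upwards [horth] with t ht
    simp only [B, dif_pos ht]
    change ht.orthogonalFamily.linearIsometry (b.repr (b i)) = _
    rw [b.repr_self, OrthogonalFamily.linearIsometry_apply_single]
    simp
  have hBn : ∀ᵐ t ∂haarAddCircle, ‖B t‖ ≤ 1 := by
    filter_upwards [hBiso] with t ht
    exact norm_le_one_of_isometry ht
  have hnorm : ∀ f, ∀ᵐ t ∂haarAddCircle, ‖(j f : L2 E) t‖ = ‖f‖ := fun f => by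
    filter_upwards [hj f f] with t ht
    rw [← sq_eq_sq₀ (norm_nonneg _) (norm_nonneg _), ← inner_self_eq_norm_sq (𝕜 := ℂ),
      ← inner_self_eq_norm_sq (𝕜 := ℂ), ht]
  refine ⟨B, hBiso, fun f => ?_⟩
  have htop : (⊤ : Submodule ℂ F) ≤ evaluated j B := by
    rw [← b.dense_span]
    refine Submodule.topologicalClosure_minimal _ (Submodule.span_le.2 ?_)
      (isClosed_evaluated hnorm hBn)
    rintro _ ⟨i, rfl⟩
    exact hBb i
  exact htop (Submodule.mem_top (x := f))

omit [CompleteSpace E] in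
/-- The pointwise inner products of functions from a wandering subspace of the shift are
constant. -/
theorem inner_apply_ae_of_mem_wandering {M : Submodule ℂ (Hardy E)}
    (hM : ∀ k, ∀ f ∈ M, hardyMul k f ∈ M) {f g : Hardy E} (hf : f ∈ wandering (hardyMul 1) M)
    (hg : g ∈ wandering (hardyMul 1) M) :
    ∀ᵐ t ∂haarAddCircle, inner ℂ ((f : L2 E) t) ((g : L2 E) t) = inner ℂ f g := by
  have hint : Integrable (fun t => inner ℂ ((f : L2 E) t) ((g : L2 E) t)) haarAddCircle :=
    L2.integrable_inner _ _
  have hcoef : ∀ n : ℤ, fourierCoeff (fun t => inner ℂ ((f : L2 E) t) ((g : L2 E) t)) n =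
      inner ℂ (charMul n (f : L2 E)) (g : L2 E) := fun n => by
    rw [L2.inner_def, fourierCoeff]
    refine integral_congr_ae ?_
    filter_upwards [charMul_ae n (f : L2 E)] with t ht
    rw [ht, inner_smul_left, fourier_neg, smul_eq_mul]
  -- Positive powers push `v` into `S M`, orthogonal to `w`; negative coefficients reduce to this by
  -- exchanging `f` and `g`.
  have hpos : ∀ n : ℕ, ∀ v ∈ wandering (hardyMul 1) M, ∀ w ∈ wandering (hardyMul 1) M,
      inner ℂ (charMul ((n : ℤ) + 1) (v : L2 E)) (w : L2 E) = 0 := fun n v hv w hw => by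
    have h := inner_map_of_mem_wandering hw (hM n v hv.1)
    rw [hardyMul_hardyMul, add_comm] at h
    exact_mod_cast h
  have hzero := ae_eq_zero_of_fourierCoeff_eq_zero
    (f := (fun t => inner ℂ ((f : L2 E) t) ((g : L2 E) t)) + (-1 : ℂ) • fun _ => inner ℂ f g)
    (hint.add ((integrable_const _).smul _)) fun n => by
      rw [fourierCoeff.add hint ((integrable_const _).smul _), Pi.add_apply, hcoef,
        fourierCoeff.const_smul, fourierCoeff_const]
      rcases lt_trichotomy n 0 with hn | rfl | hn
      · rw [if_neg hn.ne, smul_zero, add_zero, inner_charMul_left]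
        obtain ⟨m, hm⟩ := Int.eq_ofNat_of_zero_le (show 0 ≤ -n - 1 by lia)
        rw [show -n = (m : ℤ) + 1 by lia]
        exact inner_eq_zero_symm.1 (hpos m g hg f hf)
      · rw [if_pos rfl, charMul_zero, neg_one_smul]
        exact add_neg_cancel _
      · rw [if_neg hn.ne', smul_zero, add_zero]
        obtain ⟨m, hm⟩ := Int.eq_ofNat_of_zero_le (show 0 ≤ n - 1 by lia)
        rw [show n = (m : ℤ) + 1 by lia]
        exact hpos m f hf g hg
  filter_upwards [hzero] with t ht
  simpa [← sub_eq_add_neg, sub_eq_zero] using ht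

end Boundary

/-! ### From boundary isometries to an inner function -/

section InnerFunction

variable {E : Type u} [NormedAddCommGroup E] [InnerProductSpace ℂ E] [CompleteSpace E]
  {F : Type v} [NormedAddCommGroup F] [InnerProductSpace ℂ F]

/-- A field of isometries whose orbit functions have vanishing negative Fourier coefficients is
the boundary function of an inner function. -/
theorem exists_isInner {B : UnitAddCircle → F →L[ℂ] E}
    (hiso : ∀ᵐ t ∂haarAddCircle, Isometry (B t))
    (hmeas : ∀ η, AEStronglyMeasurable (fun t => B t η) haarAddCircle)
    (hneg : ∀ (η : F) (n : ℤ), n < 0 → fourierCoeff (fun t => B t η) n = 0) :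
    ∃ Θ : ℂ → F →L[ℂ] E, IsInner Θ B := by
  have hnorm : ∀ η, ∀ᵐ t ∂haarAddCircle, ‖B t η‖ ≤ ‖η‖ := fun η => by
    filter_upwards [hiso] with t ht
    rw [ht.norm_map_of_map_zero (map_zero _)]
  have hint : ∀ η, Integrable (fun t => B t η) haarAddCircle := fun η =>
    Integrable.of_bound (hmeas η) ‖η‖ (hnorm η)
  let A : ℤ → F →L[ℂ] E := fun n => LinearMap.mkContinuous
    { toFun := fun η => fourierCoeff (fun t => B t η) n
      map_add' := fun η ζ => by
        simp only [map_add]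
        exact congrFun (fourierCoeff.add (hint η) (hint ζ)) n
      map_smul' := fun c η => by
        simp only [map_smul]
        exact fourierCoeff.const_smul _ c n } 1 fun η => by
      rw [one_mul]
      refine (norm_integral_le_of_norm_le_const (C := ‖η‖) ?_).trans (by simp)
      filter_upwards [hnorm η] with t ht
      rwa [norm_smul, norm_fourier_apply, one_mul]
  have hA : ∀ n, ‖A n‖ ≤ 1 := fun n => LinearMap.mkContinuous_norm_le _ zero_le_one _
  have hsummable : ∀ z : ℂ, ‖z‖ < 1 → Summable fun n : ℕ => z ^ n • A n := fun z hz => by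
    refine Summable.of_norm_bounded (summable_geometric_of_lt_one (norm_nonneg z) hz) fun n => ?_
    rw [norm_smul, norm_pow]
    exact mul_le_of_le_one_right (by positivity) (hA n)
  let Θ : ℂ → F →L[ℂ] E := fun z => ∑' n : ℕ, z ^ n • A n
  have hsum : ∀ (η : F), ∀ z ∈ Metric.ball (0 : ℂ) 1,
      HasSum (fun n : ℕ => z ^ n • fourierCoeff (fun t => B t η) (n : ℤ)) (Θ z η) := by
    intro η z hz
    exact (hsummable z (mem_ball_zero_iff.1 hz)).hasSum.mapL (ContinuousLinearMap.apply ℂ E η)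
  refine ⟨Θ, ⟨fun z hz => ?_, 1, fun z hz => ?_⟩, ⟨hmeas, ⟨1, ?_⟩, hneg, hsum⟩, hiso⟩
  -- The series converges uniformly only on discs of radius `r < 1`.
  · obtain ⟨r, hzr, hr⟩ := exists_between (mem_ball_zero_iff.1 hz)
    have hd : DifferentiableOn ℂ Θ (Metric.ball 0 r) := by
      refine Complex.differentiableOn_tsum_of_summable_norm
        (summable_geometric_of_lt_one ((norm_nonneg z).trans hzr.le) hr)
        (fun n => ((differentiable_id.pow n).smul_const (A n)).differentiableOn)
        Metric.isOpen_ball fun n w hw => ?_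
      rw [norm_smul, norm_pow]
      refine (mul_le_of_le_one_right (by positivity) (hA n)).trans ?_
      exact pow_le_pow_left₀ (norm_nonneg _) (mem_ball_zero_iff.1 hw).le n
    exact (hd.differentiableAt
      (Metric.isOpen_ball.mem_nhds (mem_ball_zero_iff.2 hzr))).differentiableWithinAt
  -- Coefficient bounds alone would give `(1 - ‖z‖)⁻¹`; the Poisson integral gives the uniform bound
  -- `1`.
  · refine ContinuousLinearMap.opNorm_le_bound _ zero_le_one fun η => ?_
    rw [one_mul]
    exact norm_le_of_hasSum_pow_smul_fourierCoeff (hint η) (hneg η) (hnorm η)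
      (mem_ball_zero_iff.1 hz) (hsum η z hz)
  · filter_upwards [hiso] with t ht
    exact norm_le_one_of_isometry ht

end InnerFunction

/-! ### Unitary parts of Toeplitz operators -/

section Main

variable {E : Type u} [NormedAddCommGroup E] [InnerProductSpace ℂ E] [CompleteSpace E]
  {Φ : UnitAddCircle → E →L[ℂ] E}

omit [CompleteSpace E] in
theorem IsInner.memLp {F : Type v} [NormedAddCommGroup F] [InnerProductSpace ℂ F]
    {Θ : ℂ → F →L[ℂ] E} {B : UnitAddCircle → F →L[ℂ] E} (h : IsInner Θ B) (η : F) :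
    MemLp (fun t => B t η) 2 (haarAddCircle : Measure UnitAddCircle) := by
  refine MemLp.of_bound (h.isBoundary.aesm η) ‖η‖ ?_
  filter_upwards [h.isometry] with t ht
  rw [ht.norm_map_of_map_zero (map_zero _)]

/-- The isometric embedding `η ↦ Θ(·)η` of `F` into `H²_E(𝔻)` given by an inner function. -/
noncomputable def IsInner.embed {F : Type v} [NormedAddCommGroup F] [InnerProductSpace ℂ F]
    {Θ : ℂ → F →L[ℂ] E} {B : UnitAddCircle → F →L[ℂ] E} (h : IsInner Θ B) : F →ₗᵢ[ℂ] Hardy E where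
  toFun η := ⟨(h.memLp η).toLp, fun n hn => by
    rw [fourierCoeff_congr_ae (h.memLp η).coeFn_toLp]
    exact h.isBoundary.coeff_neg η n hn⟩
  map_add' η ζ := Subtype.ext <| by
    change _ = (h.memLp η).toLp + (h.memLp ζ).toLp
    exact MemLp.toLp_congr (h.memLp (η + ζ)) ((h.memLp η).add (h.memLp ζ)) (Filter.Eventually.of_forall fun t => map_add (B t) η ζ)
  map_smul' c η := Subtype.ext <| by
    change _ = c • (h.memLp η).toLp
    exact MemLp.toLp_congr (h.memLp (c • η)) ((h.memLp η).const_smul c) (Filter.Eventually.of_forall fun t => map_smul (B t) c η)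
  norm_map' η := by
    change ‖(h.memLp η).toLp‖ = ‖η‖
    rw [Lp.norm_toLp, eLpNorm_congr_norm_ae (g := fun _ => η)]
    · rw [eLpNorm_const _ two_ne_zero (NeZero.ne _)]
      simp
    · filter_upwards [h.isometry] with t ht
      rw [ht.norm_map_of_map_zero (map_zero _)]

omit [CompleteSpace E] in
theorem IsInner.embed_ae {F : Type v} [NormedAddCommGroup F] [InnerProductSpace ℂ F]
    {Θ : ℂ → F →L[ℂ] E} {B : UnitAddCircle → F →L[ℂ] E} (h : IsInner Θ B) (η : F) :
    (h.embed η : L2 E) =ᵐ[haarAddCircle] fun t => B t η :=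
  (h.memLp η).coeFn_toLp

theorem IsInner.toeplitz_embed {F : Type v} [NormedAddCommGroup F] [InnerProductSpace ℂ F]
    {Θ : ℂ → F →L[ℂ] E} {B : UnitAddCircle → F →L[ℂ] E} (h : IsInner Θ B) (hΦ : MemLInfty Φ)
    {U : F →L[ℂ] F} (hU : ∀ᵐ t ∂haarAddCircle, Φ t ∘L B t = B t ∘L U) (η : F) :
    toeplitz Φ hΦ (h.embed η) = h.embed (U η) := by
  have hL : laurent Φ hΦ (h.embed η) = h.embed (U η) := by
    refine Lp.ext ?_
    filter_upwards [laurent_apply_ae hΦ (h.embed η), h.embed_ae η, h.embed_ae (U η), hU]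
      with t h1 h2 h3 h4
    rw [h1, h2, h3]
    exact DFunLike.congr_fun h4 η
  refine Subtype.ext ?_
  rw [coe_toeplitz_of_mem hΦ (hL ▸ (h.embed (U η)).2), hL]

/-- The range of `η ↦ Θ η` already reduces `T`: there `T` acts as `U` and `T*` as `U*`. -/
theorem hasUnitaryPart_of_isInner (hΦ : MemLInfty Φ) {F : Type v} [NormedAddCommGroup F]
    [InnerProductSpace ℂ F] [CompleteSpace F] [Nontrivial F] {Θ : ℂ → F →L[ℂ] E}
    {B : UnitAddCircle → F →L[ℂ] E} (h : IsInner Θ B) {U : F →L[ℂ] F}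
    (hU : U ∈ unitary (F →L[ℂ] F)) (h1 : ∀ᵐ t ∂haarAddCircle, Φ t ∘L B t = B t ∘L U)
    (h2 : ∀ᵐ t ∂haarAddCircle, ContinuousLinearMap.adjoint (Φ t) ∘L B t =
      B t ∘L ContinuousLinearMap.adjoint U) : HasUnitaryPart (toeplitz Φ hΦ) := by
  have hT := h.toeplitz_embed hΦ h1
  have hT' := h.toeplitz_embed hΦ.adjoint h2
  rw [← adjoint_toeplitz hΦ] at hT'
  rw [Unitary.mem_iff, ContinuousLinearMap.star_eq_adjoint] at hU
  have hred : IsReducing (toeplitz Φ hΦ) (LinearMap.range h.embed.toLinearMap) := by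
    refine ⟨h.embed.isometry.isClosedEmbedding.isClosed_range, ?_, ?_⟩
    · rintro _ ⟨η, rfl⟩
      exact ⟨U η, (hT η).symm⟩
    · rintro _ ⟨η, rfl⟩
      exact ⟨_, (hT' η).symm⟩
  refine ⟨_, fun hbot => ?_, hred, hred.isUnitaryOn ?_ ?_⟩
  · obtain ⟨η, hη⟩ := exists_ne (0 : F)
    have : h.embed η = 0 := (Submodule.eq_bot_iff _).1 hbot _ ⟨η, rfl⟩
    exact hη (h.embed.injective (this.trans (map_zero _).symm))
  · rintro _ ⟨η, rfl⟩
    change ContinuousLinearMap.adjoint (toeplitz Φ hΦ) (toeplitz Φ hΦ (h.embed η)) = h.embed η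
    rw [hT, hT']
    exact congrArg h.embed (DFunLike.congr_fun hU.1 η)
  · rintro _ ⟨η, rfl⟩
    change toeplitz Φ hΦ (ContinuousLinearMap.adjoint (toeplitz Φ hΦ) (h.embed η)) = h.embed η
    rw [hT', hT]
    exact congrArg h.embed (DFunLike.congr_fun hU.2 η)

omit [CompleteSpace E] in
-- The exceptional null set depends on `η`; a dense sequence and continuity give a common one.
theorem ae_eq_of_forall_apply_ae_eq {F : Type*} [NormedAddCommGroup F] [NormedSpace ℂ F]
    [TopologicalSpace.SeparableSpace F] {A B : UnitAddCircle → F →L[ℂ] E}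
    (h : ∀ η, ∀ᵐ t ∂haarAddCircle, A t η = B t η) : ∀ᵐ t ∂haarAddCircle, A t = B t := by
  have h' : ∀ᵐ t ∂haarAddCircle, ∀ n,
      A t (TopologicalSpace.denseSeq F n) = B t (TopologicalSpace.denseSeq F n) :=
    ae_all_iff.2 fun n => h _
  filter_upwards [h'] with t ht
  exact DFunLike.coe_injective ((TopologicalSpace.denseRange_denseSeq F).equalizer
    (A t).continuous (B t).continuous (funext ht))

theorem HasUnitaryPart.ne_bot {H : Type u} [NormedAddCommGroup H] [InnerProductSpace ℂ H]
    [CompleteSpace H] {T : H →L[ℂ] H} (h : HasUnitaryPart T) {M : Submodule ℂ H}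
    (hM : IsUnitarySpace T M) : M ≠ ⊥ := by
  rintro rfl
  obtain ⟨N, hN, hN'⟩ := h
  exact hN (le_bot_iff.1 (hM.2 hN'))

/-- The wandering subspace of the unitary space of a contractive Toeplitz operator `T_Φ`: it
reduces `T_Φ` to a unitary operator, which acts as multiplication by `Φ`. -/
theorem exists_wandering_unitarySpace (hΦ : MemLInfty Φ) (hT : ‖toeplitz Φ hΦ‖ ≤ 1) :
    ∃ M : Submodule ℂ (Hardy E), IsUnitarySpace (toeplitz Φ hΦ) M ∧
      (∀ k, ∀ f ∈ M, hardyMul k f ∈ M) ∧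
      IsReducing (toeplitz Φ hΦ) (wandering (hardyMul 1) M) ∧
      IsUnitaryOn (toeplitz Φ hΦ) (wandering (hardyMul 1) M) ∧
      (∀ k, ∀ f ∈ M, toeplitz Φ hΦ (hardyMul k f) = hardyMul k (toeplitz Φ hΦ f)) ∧
      (∀ f ∈ M, laurent Φ hΦ f = (toeplitz Φ hΦ f : L2 E)) ∧
      (∀ f ∈ M, laurent _ hΦ.adjoint f =
        (ContinuousLinearMap.adjoint (toeplitz Φ hΦ) f : L2 E)) := by
  obtain ⟨M, hM, hsM, hc, hc', hL, hL'⟩ := exists_isUnitarySpace_toeplitz hΦ hT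
  have hr := hM.1.1.wandering (hc 1) (hc' 1)
  exact ⟨M, hM, hsM, hr, hr.isUnitaryOn
    (fun x hx => hM.1.2.adjoint_apply_apply hT hx.1)
    (fun x hx => hM.1.2.apply_adjoint_apply hT hx.1), hc, hL, hL'⟩

theorem exists_isInner_of_hasUnitaryPart (hΦ : MemLInfty Φ) (hT : ‖toeplitz Φ hΦ‖ ≤ 1)
    (h : HasUnitaryPart (toeplitz Φ hΦ)) :
    ∃ (F : Type u) (_ : NormedAddCommGroup F) (_ : InnerProductSpace ℂ F) (_ : CompleteSpace F)
      (_ : Nontrivial F) (Θ : ℂ → F →L[ℂ] E) (B : UnitAddCircle → F →L[ℂ] E) (U : F →L[ℂ] F),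
      IsInner Θ B ∧ U ∈ unitary (F →L[ℂ] F) ∧
      (∀ᵐ t ∂haarAddCircle, Φ t ∘L B t = B t ∘L U) ∧
      (∀ᵐ t ∂haarAddCircle, ContinuousLinearMap.adjoint (Φ t) ∘L B t =
        B t ∘L ContinuousLinearMap.adjoint U) := by
  obtain ⟨M, hM, hsM, hr, hu, -, hL, hL'⟩ := exists_wandering_unitarySpace hΦ hT
  have hW := wandering_ne_bot hM.1.1.isClosed hsM hardyMul_zero hardyMul_hardyMul
    (fun x _ h => eq_zero_of_forall_mem_range_hardyMul h) (h.ne_bot hM)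
  -- The wandering subspace may be nonseparable, and then evaluation need not be an isometry off a
  -- single null set.
  obtain ⟨N, hNW, hN0, hNr, hNu, hNs⟩ := hr.exists_separable hu hT hW
  obtain ⟨F, _, _, _, j, U, hj, hU, hUT, hUT'⟩ := hNu.exists_unitary hT hNr
  have hjW : ∀ f, j f ∈ wandering (hardyMul 1) M := fun f => hNW (hj.le ⟨f, rfl⟩)
  have : TopologicalSpace.SeparableSpace F := by
    rw [← hj] at hNs
    have : TopologicalSpace.SeparableSpace (Set.range j) := hNs.separableSpace
    exact j.isometry.isEmbedding.toHomeomorph.symm.surjective.denseRange.separableSpace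
      j.isometry.isEmbedding.toHomeomorph.symm.continuous
  have : Nontrivial F := by
    by_contra hF
    rw [not_nontrivial_iff_subsingleton] at hF
    refine hN0 ((Submodule.eq_bot_iff _).2 fun x hx => ?_)
    rw [← hj] at hx
    obtain ⟨f, rfl⟩ := hx
    rw [Subsingleton.elim f 0, map_zero]
  obtain ⟨B, hBiso, hB⟩ := exists_isometry_field (j := j) fun f g => by
    have h := inner_apply_ae_of_mem_wandering hsM (hjW f) (hjW g)
    rwa [j.inner_map_map] at h
  obtain ⟨Θ, hΘ⟩ := exists_isInner hBiso
    (fun f => (Lp.aestronglyMeasurable (j f : L2 E)).congr (hB f).symm)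
    (fun f n hn => by
      rw [fourierCoeff_congr_ae (hB f)]
      exact (j f).2 n hn)
  refine ⟨F, _, _, inferInstance, inferInstance, Θ, B, U, hΘ, hU,
    ae_eq_of_forall_apply_ae_eq fun f => ?_, ae_eq_of_forall_apply_ae_eq fun f => ?_⟩
  · have h1 := laurent_apply_ae hΦ (j f : L2 E)
    rw [hL _ (hjW f).1, ← hUT] at h1
    filter_upwards [h1, hB f, hB (U f)] with t h1 h2 h3
    rw [ContinuousLinearMap.comp_apply, ContinuousLinearMap.comp_apply, h2, h3, h1]
  · have h1 := laurent_apply_ae hΦ.adjoint (j f : L2 E)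
    rw [hL' _ (hjW f).1, ← hUT'] at h1
    filter_upwards [h1, hB f, hB (ContinuousLinearMap.adjoint U f)] with t h1 h2 h3
    rw [ContinuousLinearMap.comp_apply, ContinuousLinearMap.comp_apply, h2, h3, h1]

theorem exists_equiv_toeplitz_const (hΦ : MemLInfty Φ) (hT : ‖toeplitz Φ hΦ‖ ≤ 1) :
    ∃ M : Submodule ℂ (Hardy E), IsUnitarySpace (toeplitz Φ hΦ) M ∧
      ∃ (F : Type u) (_ : NormedAddCommGroup F) (_ : InnerProductSpace ℂ F) (_ : CompleteSpace F)
        (U : F →L[ℂ] F) (V : Hardy F ≃ₗᵢ[ℂ] M), U ∈ unitary (F →L[ℂ] F) ∧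
        ∀ f : Hardy F, (V (toeplitz (fun _ => U) (MemLInfty.const U) f) : Hardy E) =
          toeplitz Φ hΦ (V f) := by
  obtain ⟨M, hM, hsM, hr, hu, hc, -, -⟩ := exists_wandering_unitarySpace hΦ hT
  obtain ⟨F, _, _, _, j, U, hj, hU, hUT, -⟩ := hu.exists_unitary hT hr
  obtain ⟨V, hV⟩ := exists_equiv_of_isHilbertSum hj hM.1.1.isClosed hsM hardyMul_zero
    hardyMul_hardyMul (fun x _ h => eq_zero_of_forall_mem_range_hardyMul h)
    isHilbertSum_monomial
  refine ⟨M, hM, F, _, _, inferInstance, U, V, hU, fun f => ?_⟩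
  let VL : Hardy F →L[ℂ] Hardy E := M.subtypeL ∘L V.toContinuousLinearEquiv.toContinuousLinearMap
  have hcomm : VL ∘L toeplitz (fun _ => U) (MemLInfty.const U) = toeplitz Φ hΦ ∘L VL := by
    -- On monomials both sides equal `S^k T (j w)`, because `T` commutes with the shift on `M`.
    refine hardy_ext fun k w => ?_
    change (V (toeplitz (fun _ => U) (MemLInfty.const U) (monomial k w)) : Hardy E) =
      toeplitz Φ hΦ (V (monomial k w))
    rw [toeplitz_const_monomial, hV, hV, hUT, hc k (j w) (hj.le ⟨w, rfl⟩).1]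
  exact DFunLike.congr_fun hcomm f

end Main

end ToeplitzUnitaryPart

open ToeplitzUnitaryPart in
theorem theorem3p2 {E : Type u} [NormedAddCommGroup E] [InnerProductSpace ℂ E] [CompleteSpace E]
    (Φ : UnitAddCircle → E →L[ℂ] E) (hΦ : MemLInfty Φ) (hT : ‖toeplitz Φ hΦ‖ ≤ 1) :
    (HasUnitaryPart (toeplitz Φ hΦ) ↔
      ∃ (F : Type u) (_ : NormedAddCommGroup F) (_ : InnerProductSpace ℂ F) (_ : CompleteSpace F)
        (_ : Nontrivial F) (Θ : ℂ → F →L[ℂ] E) (B : UnitAddCircle → F →L[ℂ] E)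
        (U : F →L[ℂ] F),
        IsInner Θ B ∧ U ∈ unitary (F →L[ℂ] F) ∧
        (∀ᵐ t ∂haarAddCircle, Φ t ∘L B t = B t ∘L U) ∧
        (∀ᵐ t ∂haarAddCircle, ContinuousLinearMap.adjoint (Φ t) ∘L B t =
          B t ∘L ContinuousLinearMap.adjoint U)) ∧
    (HasUnitaryPart (toeplitz Φ hΦ) →
      ∃ M : Submodule ℂ (Hardy E), IsUnitarySpace (toeplitz Φ hΦ) M ∧
      ∃ (F : Type u) (_ : NormedAddCommGroup F) (_ : InnerProductSpace ℂ F) (_ : CompleteSpace F)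
        (U : F →L[ℂ] F) (V : Hardy F ≃ₗᵢ[ℂ] M),
        U ∈ unitary (F →L[ℂ] F) ∧
        ∀ f : Hardy F, (V (toeplitz (fun _ => U) (MemLInfty.const U) f) : Hardy E) =
          toeplitz Φ hΦ (V f)) := by
  refine ⟨⟨exists_isInner_of_hasUnitaryPart hΦ hT, ?_⟩, fun _ => exists_equiv_toeplitz_const hΦ hT⟩
  rintro ⟨F, _, _, _, _, Θ, B, U, h, hU, h1, h2⟩
  exact hasUnitaryPart_of_isInner hΦ h hU h1 h2
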